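/- Let $\mathbb{P}$ be a probability measure on the space of environments $\Omega=(0,1)^{\mathbb{Z}}$ (with the product topology and its Borel $\sigma$-algebra). Write $\omega=(\omega_x^+)_{x\in\mathbb{Z}}\in\Omega$, $\omega_x^-:=1-\omega_x^+$ and $\rho_x:=\omega_x^- /\omega_x^+$. Assume that $\mathbb{P}$ is stationary and ergodic with respect to the shift $(\omega_x^+)_{x}\mapsto(\omega_{x+1}^+)_{x}$, and that $\mathbb{E}[\log\rho_0]$ is well defined, possibly equal to $\pm\infty$ (i.e. $\log\rho_0$ has an integrable positive part or an integrable negative part). For $\lambda\in\mathbb{R}$ set $$\omega_x^-(\lambda):=\frac{\omega_x^-e^{-\lambda}}{\omega_x^-e^{-\lambda}+\omega_x^+e^{\lambda}},\qquad \omega_x^+(\lambda):=\frac{\omega_x^+e^{\lambda}}{\omega_x^-e^{-\lambda}+\omega_x^+e^{\lambda}},$$ and let $(X_n)_{n\ge 0}$ be, under $P_0^{\omega,\lambda}$, the discrete-time Markov chain on $\mathbb{Z}$ started at $0$ that jumps from $x$ to $x\pm1$ with probability $\omega_x^{\pm}(\lambda)$. For every $\lambda\in\mathbb{R}$ there is a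 (unique) deterministic number $v_X(\lambda)\in\mathbb{R}$ such that, for $\mathbb{P}$-almost every $\omega$, $X_n/n\to v_X(\lambda)$ as $n\to\infty$, $P_0^{\omega,\lambda}$-almost surely. Define $$\lambda_-:=\sup\{\lambda\in\mathbb{R}: v_X(\lambda)<0\},\qquad \lambda_+:=\inf\{\lambda\in\mathbb{R}: v_X(\lambda)>0\}$$ in $[-\infty,+\infty]$, with $\sup\emptyset=-\infty$ and $\inf\emptyset=+\infty$. Then: 1. $v_X$ is nondecreasing on $\mathbb{R}$, and $\lambda_-\le\lambda_+$; 2. $v_X$ is strictly increasing and real-analytic on $(-\infty,\lambda_-)$, and strictly increasing and real-analytic on $(\lambda_+,+\infty)$; 3. $v_X(\lambda)=0$ for every $\lambda\in(\lambda_-,\lambda_+)$. -/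

import Mathlib

open MeasureTheory ProbabilityTheory Filter Topology

namespace RWRE

/-- The space `(0,1)^ℤ` of environments, with the product topology and the product σ-algebra.
The coordinate `ω x` is the probability `ω_x^+` of jumping from `x` to `x + 1`. -/
abbrev Env : Type := ℤ → Set.Ioo (0 : ℝ) 1

/-- The spatial shift `(θ ω)_x = ω_{x+1}`. -/
def shift (ω : Env) : Env := fun x => ω (x + 1)

/-- `ω_x^+`. -/
def right (ω : Env) (x : ℤ) : ℝ := (ω x : ℝ)

/-- `ω_x^- = 1 - ω_x^+`. -/
def left (ω : Env) (x : ℤ) : ℝ := 1 - (ω x : ℝ)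

/-- `ρ_x = ω_x^- / ω_x^+`. -/
noncomputable def rho (ω : Env) (x : ℤ) : ℝ := left ω x / right ω x

/-- The expectation of the real random variable `f` is well defined in `[-∞, +∞]`:
its positive part or its negative part has a finite expectation. -/
def HasExtendedMean (P : Measure Env) (f : Env → ℝ) : Prop :=
  (∫⁻ ω, ENNReal.ofReal (f ω) ∂P) < ⊤ ∨ (∫⁻ ω, ENNReal.ofReal (-f ω) ∂P) < ⊤

/-- `ω_x^+(lam)`, the probability of a jump to the right under the bias `lam`. -/
noncomputable def biasedRight (ω : Env) (lam : ℝ) (x : ℤ) : ℝ :=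
  right ω x * Real.exp lam / (left ω x * Real.exp (-lam) + right ω x * Real.exp lam)

/-- `ω_x^-(lam)`, the probability of a jump to the left under the bias `lam`. -/
noncomputable def biasedLeft (ω : Env) (lam : ℝ) (x : ℤ) : ℝ :=
  left ω x * Real.exp (-lam) / (left ω x * Real.exp (-lam) + right ω x * Real.exp lam)

theorem right_pos (ω : Env) (x : ℤ) : 0 < right ω x := (ω x).2.1

theorem left_pos (ω : Env) (x : ℤ) : 0 < left ω x := sub_pos.2 (ω x).2.2

theorem weight_pos (ω : Env) (lam : ℝ) (x : ℤ) :
    0 < left ω x * Real.exp (-lam) + right ω x * Real.exp lam :=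
  add_pos (mul_pos (left_pos ω x) (Real.exp_pos _)) (mul_pos (right_pos ω x) (Real.exp_pos _))

theorem biasedRight_nonneg (ω : Env) (lam : ℝ) (x : ℤ) : 0 ≤ biasedRight ω lam x :=
  div_nonneg (mul_pos (right_pos ω x) (Real.exp_pos _)).le (weight_pos ω lam x).le

theorem biasedLeft_nonneg (ω : Env) (lam : ℝ) (x : ℤ) : 0 ≤ biasedLeft ω lam x :=
  div_nonneg (mul_pos (left_pos ω x) (Real.exp_pos _)).le (weight_pos ω lam x).le

theorem biased_add (ω : Env) (lam : ℝ) (x : ℤ) :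
    biasedLeft ω lam x + biasedRight ω lam x = 1 := by
  rw [biasedLeft, biasedRight, ← add_div, div_self (weight_pos ω lam x).ne']

/-- The transition kernel on `ℤ` of the biased walk in the environment `ω`: from `x` to `x - 1`
with probability `ω_x^-(lam)` and to `x + 1` with probability `ω_x^+(lam)`. -/
noncomputable def stepKernel (ω : Env) (lam : ℝ) : Kernel ℤ ℤ where
  toFun x := ENNReal.ofReal (biasedLeft ω lam x) • Measure.dirac (x - 1) +
    ENNReal.ofReal (biasedRight ω lam x) • Measure.dirac (x + 1)
  measurable' := measurable_of_countable _

instance (ω : Env) (lam : ℝ) : IsMarkovKernel (stepKernel ω lam) where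
  isProbabilityMeasure x := ⟨by
    simp only [stepKernel, Kernel.coe_mk, Measure.add_apply, Measure.smul_apply, measure_univ,
      smul_eq_mul, mul_one]
    rw [← ENNReal.ofReal_add (biasedLeft_nonneg ω lam x) (biasedRight_nonneg ω lam x),
      biased_add, ENNReal.ofReal_one]⟩

/-- The transition kernel at time `n` as a function of the whole past `X_0, …, X_n`: it depends on
the past only through the present position `X_n`. -/
noncomputable def pastKernel (ω : Env) (lam : ℝ) (n : ℕ) :
    Kernel ((_ : Finset.Iic n) → ℤ) ℤ :=
  (stepKernel ω lam).comap (fun h => h ⟨n, Finset.mem_Iic.2 le_rfl⟩) (measurable_pi_apply _)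

instance (ω : Env) (lam : ℝ) (n : ℕ) : IsMarkovKernel (pastKernel ω lam n) := by
  unfold pastKernel; infer_instance

/-- The quenched law `P_0^{ω,lam}` on trajectories `ℕ → ℤ`: the law of the Markov chain with
transition kernel `stepKernel ω lam` started at the origin. -/
noncomputable def walkLaw (ω : Env) (lam : ℝ) : Measure (ℕ → ℤ) :=
  Kernel.traj (X := fun _ => ℤ) (pastKernel ω lam) 0 (fun _ => 0)

/-- `X_n / n` converges to the deterministic number `v`, for `P`-almost every environment and almost
every trajectory of the biased walk in that environment. -/
def IsVelocity (P : Measure Env) (lam v : ℝ) : Prop :=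
  ∀ᵐ ω ∂P, ∀ᵐ X ∂(walkLaw ω lam), Tendsto (fun n : ℕ => (X n : ℝ) / (n : ℝ)) atTop (𝓝 v)

/-- The asymptotic velocity `v_X(lam)`: the number `v` with `IsVelocity P lam v` (it is unique, and
unspecified if there is none). -/
noncomputable def velocity (P : Measure Env) (lam : ℝ) : ℝ :=
  Classical.epsilon (fun v : ℝ => IsVelocity P lam v)

/-- `lam_- = sup {lam : v_X(lam) < 0}` in `[-∞, +∞]`, where `sup ∅ = -∞`. -/
noncomputable def lamMinus (P : Measure Env) : EReal :=
  sSup (Real.toEReal '' {lam : ℝ | velocity P lam < 0})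

/-- `lam_+ = inf {lam : v_X(lam) > 0}` in `[-∞, +∞]`, where `inf ∅ = +∞`. -/
noncomputable def lamPlus (P : Measure Env) : EReal :=
  sInf (Real.toEReal '' {lam : ℝ | 0 < velocity P lam})

end RWRE

/-!
The jump ratios `ρ_x(lam) = ω_x^-(lam) / ω_x^+(lam)` of the biased environment are
`ρ_x exp (-2 lam)`, so the annealed mean `G(lam)` of the passage time from `0` to `1`
(`meanPassage`) is a power series in `exp (-2 lam)` with nonnegative coefficients. The velocity is
`1 / G(lam) - 1 / G'(lam)`, where `G'` is the same quantity for the mirror image of the walk and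
`1 / ∞ = 0` (`isVelocity_speed`). The two terms are never both positive, because otherwise the walk
would have two different velocities. The first term is nondecreasing in `lam`, and strictly
increasing and analytic to the right of any bias at which it is positive; the theorem follows from
this and from the mirror image.

The proof of the formula has three ingredients.

* *Ergodic theory* (`setIntegral_le_of_birkhoffSum_lt`, `ae_eventually_le_birkhoffSum`): Hopf's
  maximal ergodic theorem, and from it the half of Birkhoff's theorem that is needed. An additive
  functional of the walk with bounded increments and nonpositive drift is at most `o(n)`, by an
  exponential moment bound (`ae_eventually_additiveFunctional_le`).

* *Upper bound* (`ae_eventually_le_speed`): the speed to the right is at most `1 / G`, also when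
  `G = ∞`. Truncating the recursion for the quenched mean passage time gives a bounded function `t`
  of the environment with `ω_0^+ t - ω_0^- (t ∘ θ⁻¹) ≤ 1` and mean close to `G`. If `Φ` has the
  increments `Φ (x + 1) - Φ x = t (θ^x ω)`, then `Φ(X_n) - n` has nonpositive drift, so
  `Φ(X_n) ≤ n + o(n)`, while `Φ(x)` grows at least like `x E[t]` by the ergodic theorem.

* *Lower bound* (`ae_eventually_speed_le`): let `G < ∞`. Then the environment seen from the walk has
  an explicit finite invariant measure of mass `G` equivalent to `P`, under which the local drift
  has integral `1`. The position `X_n` is the sum of the local drifts along the trajectory up to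
  `o(n)`. By the upper bound the averages of this stationary sequence are asymptotically at most
  `1 / G`, which is their mean, so they cannot stay below it on a set of positive measure. Thus the
  ergodicity of the environment seen from the walk is not needed.
-/

namespace RWRE

/-! ### The maximal ergodic theorem and Birkhoff averages -/

section Birkhoff

variable {α : Type*}

theorem measurable_birkhoffSum [MeasurableSpace α]
    {T : α → α} (hT : Measurable T) {f : α → ℝ} (hf : Measurable f)
    (n : ℕ) : Measurable (birkhoffSum T f n) := by
  unfold birkhoffSum
  exact Finset.measurable_sum _ fun k _ => hf.comp (hT.iterate k)

theorem abs_birkhoffSum_le {T : α → α} {f : α → ℝ} {C : ℝ} (hC : ∀ x, |f x| ≤ C)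
    (n : ℕ) (x : α) : |birkhoffSum T f n x| ≤ n * C := by
  unfold birkhoffSum
  calc _ ≤ ∑ k ∈ Finset.range n, |f (T^[k] x)| := Finset.abs_sum_le_sum_abs _ _
    _ ≤ ∑ k ∈ Finset.range n, C := Finset.sum_le_sum fun k _ => hC _
    _ = n * C := by simp

/-- The largest of the Birkhoff sums `S_0 f, …, S_n f`. -/
noncomputable def maxBirkhoffSum (T : α → α) (f : α → ℝ) : ℕ → α → ℝ
  | 0, _ => 0
  | n + 1, x => max (maxBirkhoffSum T f n x) (birkhoffSum T f (n + 1) x)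

theorem measurable_maxBirkhoffSum [MeasurableSpace α] {T : α → α} (hT : Measurable T) {f : α → ℝ}
    (hf : Measurable f) (n : ℕ) : Measurable (maxBirkhoffSum T f n) := by
  induction n with
  | zero => exact measurable_const
  | succ n ih => exact ih.max (measurable_birkhoffSum hT hf _)

theorem maxBirkhoffSum_nonneg (T : α → α) (f : α → ℝ) (n : ℕ) (x : α) :
    0 ≤ maxBirkhoffSum T f n x := by
  induction n with
  | zero => exact le_rfl
  | succ n ih => exact ih.trans (le_max_left _ _)

theorem maxBirkhoffSum_le {T : α → α} {f : α → ℝ} {C : ℝ} (hC : ∀ x, |f x| ≤ C) (n : ℕ)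
    (x : α) : maxBirkhoffSum T f n x ≤ n * C := by
  have h0 : 0 ≤ C := (abs_nonneg _).trans (hC x)
  induction n with
  | zero => simp [maxBirkhoffSum]
  | succ n ih =>
    refine max_le (ih.trans ?_) ((le_abs_self _).trans (abs_birkhoffSum_le hC _ _))
    push_cast; nlinarith

theorem birkhoffSum_le_maxBirkhoffSum (T : α → α) (f : α → ℝ) {k n : ℕ} (h : k ≤ n) (x : α) :
    birkhoffSum T f k x ≤ maxBirkhoffSum T f n x := by
  induction n with
  | zero => simp [Nat.le_zero.1 h, maxBirkhoffSum]
  | succ n ih =>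
    rcases Nat.le_succ_iff.1 h with h | rfl
    · exact (ih h).trans (le_max_left _ _)
    · exact le_max_right _ _

theorem exists_maxBirkhoffSum_eq (T : α → α) (f : α → ℝ) (n : ℕ) (x : α) :
    ∃ k ≤ n, maxBirkhoffSum T f n x = birkhoffSum T f k x := by
  induction n with
  | zero => exact ⟨0, le_rfl, by simp [maxBirkhoffSum]⟩
  | succ n ih =>
    rcases max_choice (maxBirkhoffSum T f n x) (birkhoffSum T f (n + 1) x) with h | h
    · obtain ⟨k, hk, e⟩ := ih
      exact ⟨k, hk.trans n.le_succ, h.trans e⟩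
    · exact ⟨n + 1, le_rfl, h⟩

/-- Where the maximal Birkhoff sum is positive it is attained at some `k ≥ 1`, and then
`S_k f = f + S_{k-1} f ∘ T`. -/
theorem maxBirkhoffSum_le_add {T : α → α} {f : α → ℝ} {n : ℕ} {x : α}
    (h : 0 < maxBirkhoffSum T f n x) :
    maxBirkhoffSum T f n x ≤ f x + maxBirkhoffSum T f n (T x) := by
  obtain ⟨k, hk, e⟩ := exists_maxBirkhoffSum_eq T f n x
  rw [e] at h ⊢
  rcases k with _ | k
  · simp at h
  · rw [birkhoffSum_succ']
    gcongr
    exact birkhoffSum_le_maxBirkhoffSum T f (by lia) _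

/-- Hopf's maximal ergodic theorem, by Garsia's argument. -/
theorem setIntegral_nonneg_of_maxBirkhoffSum [MeasurableSpace α]
    {μ : Measure α} [IsFiniteMeasure μ] {T : α → α}
    (hT : MeasurePreserving T μ μ) {f : α → ℝ} (hf : Measurable f) {C : ℝ}
    (hC : ∀ x, |f x| ≤ C) (n : ℕ) :
    0 ≤ ∫ x in {x | 0 < maxBirkhoffSum T f n x}, f x ∂μ := by
  set M := maxBirkhoffSum T f n with hM
  have hMm : Measurable M := measurable_maxBirkhoffSum hT.measurable hf n
  have hMi : Integrable M μ := Integrable.of_bound hMm.aestronglyMeasurable (n * C)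
    (ae_of_all _ fun x => by
      rw [Real.norm_of_nonneg (maxBirkhoffSum_nonneg _ _ _ _)]; exact maxBirkhoffSum_le hC n x)
  have hMT : Integrable (fun x => M (T x)) μ := hT.integrable_comp_of_integrable hMi
  have hfi : Integrable f μ := Integrable.of_bound hf.aestronglyMeasurable C
    (ae_of_all _ fun x => hC x)
  have hE : MeasurableSet {x | 0 < M x} := measurableSet_lt measurable_const hMm
  have h1 : ∫ x in {x | 0 < M x}, M x ∂μ = ∫ x, M x ∂μ := by
    refine setIntegral_eq_integral_of_forall_compl_eq_zero fun x hx => ?_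
    exact le_antisymm (not_lt.1 hx) (maxBirkhoffSum_nonneg _ _ _ _)
  have h2 : ∫ x in {x | 0 < M x}, M (T x) ∂μ ≤ ∫ x, M x ∂μ := by
    calc _ ≤ ∫ x, M (T x) ∂μ := setIntegral_le_integral hMT
            (ae_of_all _ fun x => maxBirkhoffSum_nonneg _ _ _ _)
      _ = ∫ x, M x ∂μ := by
        conv_rhs => rw [← hT.map_eq]
        rw [integral_map hT.measurable.aemeasurable hMm.aestronglyMeasurable]
  have h3 : ∫ x in {x | 0 < M x}, M x - M (T x) ∂μ ≤ ∫ x in {x | 0 < M x}, f x ∂μ := by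
    refine setIntegral_mono_on (hMi.sub hMT).integrableOn hfi.integrableOn hE fun x hx => ?_
    have := maxBirkhoffSum_le_add (T := T) (f := f) (n := n) hx
    simp only [← hM] at this
    linarith
  rw [integral_sub hMi.integrableOn hMT.integrableOn] at h3
  linarith

/-- If the Birkhoff sums of `f` from almost every point of an invariant set `B` at some time lie
below the line of slope `β`, then the mean of `f` over `B` is at most `β`. -/
theorem setIntegral_le_of_birkhoffSum_lt [MeasurableSpace α]
    {μ : Measure α} [IsFiniteMeasure μ] {T : α → α}
    (hT : MeasurePreserving T μ μ) {f : α → ℝ} (hf : Measurable f) {C : ℝ}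
    (hC : ∀ x, |f x| ≤ C) {B : Set α} (hB : MeasurableSet B) (hTB : T ⁻¹' B = B) {β : ℝ}
    (h : ∀ᵐ x ∂μ, x ∈ B → ∃ n : ℕ, birkhoffSum T f n x < β * n) :
    ∫ x in B, f x ∂μ ≤ β * μ.real B := by
  set g : α → ℝ := B.indicator (fun x => β - f x) with hg
  have hgm : Measurable g := (measurable_const.sub hf).indicator hB
  have hgC : ∀ x, |g x| ≤ |β| + C := fun x => by
    have h0 : 0 ≤ C := (abs_nonneg _).trans (hC x)
    by_cases hx : x ∈ B
    · simp only [hg, Set.indicator_of_mem hx]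
      exact (abs_sub _ _).trans (by gcongr; exact hC x)
    · simp only [hg, Set.indicator_of_notMem hx, abs_zero]; positivity
  have hiter : ∀ k x, T^[k] x ∈ B ↔ x ∈ B := fun k x => by
    induction k with
    | zero => rfl
    | succ k ih =>
      rw [Function.iterate_succ_apply', ← ih]
      exact (Set.ext_iff.1 hTB (T^[k] x))
  have hsum : ∀ n x, x ∈ B → birkhoffSum T g n x = β * n - birkhoffSum T f n x := fun n x hx => by
    simp only [birkhoffSum]
    rw [Finset.sum_congr rfl fun k _ => by
      rw [hg, Set.indicator_of_mem ((hiter k x).2 hx)]]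
    simp [mul_comm]
  have hsum0 : ∀ n x, x ∉ B → birkhoffSum T g n x = 0 := fun n x hx => by
    simp only [birkhoffSum]
    exact Finset.sum_eq_zero fun k _ => by
      rw [hg, Set.indicator_of_notMem (fun h => hx ((hiter k x).1 h))]
  have hgi : Integrable g μ := Integrable.of_bound hgm.aestronglyMeasurable _ (ae_of_all _ hgC)
  have hfi : Integrable f μ := Integrable.of_bound hf.aestronglyMeasurable C
    (ae_of_all _ fun x => hC x)
  set E : ℕ → Set α := fun n => {x | 0 < maxBirkhoffSum T g n x}
  have hEm : ∀ n, MeasurableSet (E n) := fun n =>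
    measurableSet_lt measurable_const (measurable_maxBirkhoffSum hT.measurable hgm n)
  have hEmono : Monotone E := monotone_nat_of_le_succ fun n x hx =>
    (lt_of_lt_of_le hx (le_max_left _ _) : 0 < maxBirkhoffSum T g (n + 1) x)
  have hlim : Tendsto (fun n => ∫ x in E n, g x ∂μ) atTop (𝓝 (∫ x in ⋃ n, E n, g x ∂μ)) :=
    tendsto_setIntegral_of_monotone hEm hEmono hgi.integrableOn
  have h0 : 0 ≤ ∫ x in ⋃ n, E n, g x ∂μ :=
    ge_of_tendsto' hlim fun n => setIntegral_nonneg_of_maxBirkhoffSum hT hgm hgC n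
  have hEB : (⋃ n, E n : Set α) =ᵐ[μ] B := by
    filter_upwards [h] with x hx
    refine propext ⟨fun hxE => ?_, fun hxB => ?_⟩
    · obtain ⟨n, hn⟩ := Set.mem_iUnion.1 hxE
      by_contra hxB
      obtain ⟨k, -, e⟩ := exists_maxBirkhoffSum_eq T g n x
      have hn' : 0 < maxBirkhoffSum T g n x := hn
      rw [e, hsum0 k x hxB] at hn'
      exact lt_irrefl _ hn'
    · obtain ⟨n, hn⟩ := hx hxB
      refine Set.mem_iUnion.2 ⟨n, lt_of_lt_of_le ?_
        (birkhoffSum_le_maxBirkhoffSum T g le_rfl x)⟩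
      rw [hsum n x hxB]; linarith
  rw [setIntegral_congr_set hEB] at h0
  have h1 : ∫ x in B, g x ∂μ = ∫ x in B, (β - f x) ∂μ :=
    setIntegral_congr_fun hB fun x hx => by simp [hg, hx]
  rw [h1, integral_sub (integrable_const β).integrableOn hfi.integrableOn] at h0
  simp only [integral_const, smul_eq_mul, measureReal_restrict_apply_univ] at h0
  linarith [mul_comm β (μ.real B)]

/-- The set of points whose Birkhoff averages have an inferior limit below `K`. The condition is
written with the slopes `K - 1 / (j + 1)` instead of an inferior limit, to make the set
measurable and invariant without boundedness assumptions in the definition. -/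
def slowSet (T : α → α) (f : α → ℝ) (K : ℝ) : Set α :=
  {x | ∃ j : ℕ, ∃ᶠ n : ℕ in atTop, birkhoffSum T f n x < (K - 1 / (j + 1)) * n}

theorem measurableSet_slowSet [MeasurableSpace α]
    {T : α → α} (hT : Measurable T) {f : α → ℝ} (hf : Measurable f)
    (K : ℝ) : MeasurableSet (slowSet T f K) := by
  have : slowSet T f K = ⋃ j : ℕ, ⋂ N : ℕ, ⋃ n : ℕ, ⋃ _ : N ≤ n,
      {x | birkhoffSum T f n x < (K - 1 / (j + 1)) * n} := by
    ext x; simp [slowSet, frequently_atTop]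
  rw [this]
  exact .iUnion fun j => .iInter fun N => .iUnion fun n => .iUnion fun _ =>
    measurableSet_lt (measurable_birkhoffSum hT hf n) measurable_const

/-- Membership in `slowSet` is not affected by a change of the time by one and of the Birkhoff sums
by a bounded amount. -/
theorem mem_slowSet_of_le_add {T : α → α} {f : α → ℝ} {K D : ℝ} {m : ℕ → ℕ} {x y : α}
    (hm : Tendsto m atTop atTop) (hm' : ∀ᶠ n in atTop, |(m n : ℝ) - n| ≤ 1)
    (h : ∀ᶠ n in atTop, birkhoffSum T f (m n) y ≤ birkhoffSum T f n x + D)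
    (hx : x ∈ slowSet T f K) : y ∈ slowSet T f K := by
  obtain ⟨j, hj⟩ := hx
  have hpos : (0 : ℝ) < 1 / (j + 1) - 1 / ((j + 1 : ℕ) + 1) := by
    rw [sub_pos]; exact one_div_lt_one_div_of_lt (by positivity) (by push_cast; linarith)
  have hlarge : ∀ᶠ n : ℕ in atTop,
      D + |K - 1 / ((j + 1 : ℕ) + 1)| ≤ (1 / (j + 1) - 1 / ((j + 1 : ℕ) + 1)) * n :=
    (tendsto_natCast_atTop_atTop.const_mul_atTop hpos).eventually_ge_atTop _
  refine ⟨j + 1, hm.frequently ?_⟩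
  refine (hj.and_eventually (h.and (hm'.and hlarge))).mono fun n hn => ?_
  obtain ⟨h1, h2, h3, h4⟩ := hn
  set a := K - 1 / ((j + 1 : ℕ) + 1 : ℝ)
  have h5 : a * n - |a| ≤ a * m n := by
    have : |a * (m n - n)| ≤ |a| := by
      rw [abs_mul]; exact mul_le_of_le_one_right (abs_nonneg _) h3
    have := neg_abs_le (a * (m n - n)); nlinarith
  have : (K - 1 / (j + 1 : ℝ)) * n = a * n - (1 / (j + 1) - 1 / ((j + 1 : ℕ) + 1)) * n := by
    simp only [a]; ring
  linarith

theorem preimage_slowSet {T : α → α} {f : α → ℝ} {C : ℝ} (hC : ∀ x, |f x| ≤ C) (K : ℝ) :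
    T ⁻¹' slowSet T f K = slowSet T f K := by
  ext x
  constructor
  · refine mem_slowSet_of_le_add (m := fun n => n + 1) (D := C) (tendsto_add_atTop_nat 1)
      (.of_forall fun n => by simp) (.of_forall fun n => ?_)
    rw [birkhoffSum_succ']
    linarith [(abs_le.1 (hC x)).2]
  · refine mem_slowSet_of_le_add (m := fun n => n - 1) (D := C) (tendsto_sub_atTop_nat 1) ?_ ?_
    · filter_upwards [eventually_ge_atTop 1] with n hn
      rw [Nat.cast_sub hn]; simp
    · filter_upwards [eventually_ge_atTop 1] with n hn
      obtain ⟨k, rfl⟩ := Nat.exists_eq_add_of_le' hn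
      rw [birkhoffSum_succ', Nat.add_sub_cancel]
      linarith [(abs_le.1 (hC x)).1]

theorem exists_birkhoffSum_lt_of_mem_slowSet {T : α → α} {f : α → ℝ} {K : ℝ} {x : α}
    (hx : x ∈ slowSet T f K) : ∃ n : ℕ, birkhoffSum T f n x < K * n := by
  obtain ⟨j, hj⟩ := hx
  obtain ⟨n, hn⟩ := hj.exists
  refine ⟨n, hn.trans_le ?_⟩
  have : (0 : ℝ) ≤ 1 / (j + 1) := by positivity
  gcongr; linarith

theorem eventually_le_of_notMem_slowSet {T : α → α} {f : α → ℝ} {K K' : ℝ} {x : α}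
    (hx : x ∉ slowSet T f K) (hK : K' < K) :
    ∀ᶠ n : ℕ in atTop, K' * n ≤ birkhoffSum T f n x := by
  obtain ⟨j, hj⟩ := exists_nat_one_div_lt (sub_pos.2 hK)
  simp only [slowSet, Set.mem_ofPred_eq, not_exists, not_frequently, not_lt] at hx
  filter_upwards [hx j] with n hn
  refine le_trans ?_ hn
  gcongr; linarith

/-- The lower half of Birkhoff's theorem for a bounded function and an ergodic transformation. -/
theorem ae_eventually_le_birkhoffSum [MeasurableSpace α]
    {μ : Measure α} [IsProbabilityMeasure μ] {T : α → α}
    (hT : Ergodic T μ) {f : α → ℝ} (hf : Measurable f) {C : ℝ} (hC : ∀ x, |f x| ≤ C) {K : ℝ}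
    (hK : K < ∫ x, f x ∂μ) : ∀ᵐ x ∂μ, ∀ᶠ n : ℕ in atTop, K * n ≤ birkhoffSum T f n x := by
  obtain ⟨K', h1, h2⟩ := exists_between hK
  have hB := measurableSet_slowSet hT.measurable hf K'
  rcases hT.prob_eq_zero_or_one hB (preimage_slowSet hC K') with h | h
  · have : ∀ᵐ x ∂μ, x ∉ slowSet T f K' := measure_eq_zero_iff_ae_notMem.1 h
    filter_upwards [this] with x hx
    exact eventually_le_of_notMem_slowSet hx h1
  · have := setIntegral_le_of_birkhoffSum_lt hT.toMeasurePreserving hf hC hB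
      (preimage_slowSet hC K') (ae_of_all _ fun x => exists_birkhoffSum_lt_of_mem_slowSet)
    have hae : ∀ᵐ x ∂μ, x ∈ slowSet T f K' := by
      rw [ae_iff, ← Set.compl_def]; exact (prob_compl_eq_zero_iff hB).2 h
    rw [measureReal_def, h, Measure.restrict_eq_self_of_ae_mem hae] at this
    simp only [ENNReal.toReal_one, mul_one] at this
    linarith

end Birkhoff

/-! ### The law of the walk -/

/-- The cylinder of the trajectories which agree with `x` up to time `n`. -/
def pathCylinder (n : ℕ) (x : ℕ → ℤ) : Set (ℕ → ℤ) := {X | ∀ i ≤ n, X i = x i}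

theorem measurableSet_pathCylinder (n : ℕ) (x : ℕ → ℤ) : MeasurableSet (pathCylinder n x) := by
  have : pathCylinder n x = ⋂ i : ℕ, ⋂ _ : i ≤ n, (fun X : ℕ → ℤ => X i) ⁻¹' {x i} := by
    ext X; simp [pathCylinder]
  rw [this]
  exact .iInter fun i => .iInter fun _ => measurable_pi_apply i (measurableSet_singleton _)

theorem pathCylinder_inter_of_le {m n : ℕ} (h : m ≤ n) {x y : ℕ → ℤ}
    (hne : (pathCylinder m x ∩ pathCylinder n y).Nonempty) :
    pathCylinder m x ∩ pathCylinder n y = pathCylinder n y := by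
  obtain ⟨Z, hZx, hZy⟩ := hne
  refine Set.inter_eq_right.2 fun X hX i hi => ?_
  rw [hX i (hi.trans h), ← hZy i (hi.trans h), hZx i hi]

/-- The collection of all the cylinders `pathCylinder n x`. -/
def pathCylinders : Set (Set (ℕ → ℤ)) := {s | ∃ n x, s = pathCylinder n x}

theorem isPiSystem_pathCylinders : IsPiSystem pathCylinders := by
  rintro _ ⟨m, x, rfl⟩ _ ⟨n, y, rfl⟩ hne
  rcases le_total m n with h | h
  · exact ⟨n, y, pathCylinder_inter_of_le h hne⟩
  · rw [Set.inter_comm] at hne ⊢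
    exact ⟨m, x, pathCylinder_inter_of_le h hne⟩

theorem generateFrom_pathCylinders :
    (MeasurableSpace.pi : MeasurableSpace (ℕ → ℤ)) =
      MeasurableSpace.generateFrom pathCylinders := by
  refine le_antisymm (iSup_le fun i => ?_) (MeasurableSpace.generateFrom_le ?_)
  · rw [← measurable_iff_comap_le]
    refine @measurable_to_countable' _ _ _ _ (MeasurableSpace.generateFrom pathCylinders) _
      fun a => ?_
    have : (fun X : ℕ → ℤ => X i) ⁻¹' {a} =
        ⋃ x : ℕ →₀ ℤ, ⋃ _ : x i = a, pathCylinder i x := by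
      ext X
      simp only [Set.mem_preimage, Set.mem_singleton_iff, Set.mem_iUnion]
      constructor
      · intro h
        refine ⟨Finsupp.indicator (Finset.range (i + 1)) fun j _ => X j, ?_, fun j hj => ?_⟩
        · rw [Finsupp.indicator_of_mem (by simp), h]
        · rw [Finsupp.indicator_of_mem (by simpa using Nat.lt_succ_of_le hj)]
      · rintro ⟨x, hx, h⟩
        rw [h i le_rfl, hx]
    rw [this]
    exact MeasurableSet.iUnion fun x => MeasurableSet.iUnion fun _ =>
      MeasurableSpace.measurableSet_generateFrom ⟨i, x, rfl⟩
  · rintro _ ⟨n, x, rfl⟩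
    exact measurableSet_pathCylinder n x

theorem stepKernel_singleton (ω : Env) (lam : ℝ) (x y : ℤ) :
    stepKernel ω lam x {y} =
      ENNReal.ofReal (biasedLeft ω lam x) * (if y = x - 1 then 1 else 0) +
      ENNReal.ofReal (biasedRight ω lam x) * (if y = x + 1 then 1 else 0) := by
  simp [stepKernel, Set.indicator_apply, eq_comm]

instance (ω : Env) (lam : ℝ) : IsProbabilityMeasure (walkLaw ω lam) := by
  unfold walkLaw; infer_instance

theorem walkLaw_pathCylinder_zero (ω : Env) (lam : ℝ) (x : ℕ → ℤ) :
    walkLaw ω lam (pathCylinder 0 x) = if x 0 = 0 then 1 else 0 := by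
  have h := Kernel.traj_map_frestrictLe_apply (X := fun _ => ℤ) (κ := pastKernel ω lam) 0 0
    (fun _ => 0)
  rw [Kernel.partialTraj_self, Kernel.id_apply] at h
  have h2 := congrArg (fun μ => μ {Preorder.frestrictLe (π := fun _ => ℤ) 0 x}) h
  rw [Measure.map_apply (by fun_prop) (measurableSet_singleton _)] at h2
  have e : Preorder.frestrictLe (π := fun _ => ℤ) 0 ⁻¹' {Preorder.frestrictLe 0 x}
      = pathCylinder 0 x := by
    ext X
    simp [pathCylinder, funext_iff, Preorder.frestrictLe]
  rw [e] at h2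
  rw [walkLaw, h2, Measure.dirac_apply' _ (measurableSet_singleton _), Set.indicator_apply]
  congr 1
  simp [funext_iff, Preorder.frestrictLe, eq_comm]

theorem walkLaw_pathCylinder_succ (ω : Env) (lam : ℝ) (n : ℕ) (x : ℕ → ℤ) :
    walkLaw ω lam (pathCylinder (n + 1) x) =
      walkLaw ω lam (pathCylinder n x) * stepKernel ω lam (x n) {x (n + 1)} := by
  have hr : ∀ X : ℕ → ℤ, Preorder.frestrictLe (π := fun _ => ℤ) n X = Preorder.frestrictLe n x ↔
      X ∈ pathCylinder n x := fun X => by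
    simp [pathCylinder, funext_iff, Preorder.frestrictLe]
  have h := Kernel.partialTraj_compProd_eq_map_traj (X := fun _ => ℤ) (κ := pastKernel ω lam)
    (Nat.zero_le n) (x₀ := fun _ => 0)
  have h2 := congrArg (fun μ => μ ({Preorder.frestrictLe (π := fun _ => ℤ) n x} ×ˢ {x (n + 1)})) h
  rw [Measure.compProd_apply_prod (measurableSet_singleton _) (measurableSet_singleton _),
    lintegral_singleton, Measure.map_apply (by fun_prop)
      ((measurableSet_singleton _).prod (measurableSet_singleton _)),
    ← Kernel.traj_map_frestrictLe_apply,
    Measure.map_apply (by fun_prop) (measurableSet_singleton _)] at h2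
  have e1 : Preorder.frestrictLe (π := fun _ => ℤ) n ⁻¹' {Preorder.frestrictLe n x}
      = pathCylinder n x := by
    ext X; exact hr X
  have e2 : (fun X : ℕ → ℤ => (Preorder.frestrictLe (π := fun _ => ℤ) n X, X (n + 1))) ⁻¹'
      ({Preorder.frestrictLe n x} ×ˢ {x (n + 1)}) = pathCylinder (n + 1) x := by
    ext X
    rw [Set.mem_preimage, Set.mem_prod]
    simp only [Set.mem_singleton_iff]
    rw [hr]
    refine ⟨fun h i hi => ?_, fun h => ⟨fun i hi => h i (by lia), h _ le_rfl⟩⟩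
    rcases Nat.le_succ_iff.1 hi with hi | rfl
    exacts [h.1 i hi, h.2]
  rw [e1, e2] at h2
  rw [walkLaw, ← h2, mul_comm]
  rfl

/-- The law of the walk is the only probability measure on trajectories with the Markovian values
on cylinders. -/
theorem eq_walkLaw {ω : Env} {lam : ℝ} {μ : Measure (ℕ → ℤ)} [IsProbabilityMeasure μ]
    (h0 : ∀ x, μ (pathCylinder 0 x) = if x 0 = 0 then 1 else 0)
    (hs : ∀ n x, μ (pathCylinder (n + 1) x) =
      μ (pathCylinder n x) * stepKernel ω lam (x n) {x (n + 1)}) :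
    μ = walkLaw ω lam := by
  refine ext_of_generate_finite pathCylinders generateFrom_pathCylinders isPiSystem_pathCylinders
    ?_ (by simp)
  rintro _ ⟨n, x, rfl⟩
  induction n with
  | zero => rw [h0, walkLaw_pathCylinder_zero]
  | succ n ih => rw [hs, walkLaw_pathCylinder_succ, ih]

theorem ae_walkLaw_zero (ω : Env) (lam : ℝ) : ∀ᵐ X ∂walkLaw ω lam, X 0 = 0 := by
  have h := walkLaw_pathCylinder_zero ω lam 0
  simp only [Pi.zero_apply, if_true] at h
  have := (prob_compl_eq_zero_iff (measurableSet_pathCylinder 0 0)).2 h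
  filter_upwards [measure_eq_zero_iff_ae_notMem.1 this] with X hX
  simpa [pathCylinder] using hX

/-- The environment seen from the site `z`. -/
def shiftBy (z : ℤ) (ω : Env) : Env := fun x => ω (x + z)

theorem shiftBy_zero (ω : Env) : shiftBy 0 ω = ω := by ext; simp [shiftBy]

theorem shiftBy_shiftBy (y z : ℤ) (ω : Env) : shiftBy y (shiftBy z ω) = shiftBy (y + z) ω := by
  funext x; simp [shiftBy, add_assoc]

theorem measurable_shiftBy (z : ℤ) : Measurable (shiftBy z) :=
  measurable_pi_iff.2 fun x => measurable_pi_apply (x + z)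

theorem biasedLeft_shiftBy (z : ℤ) (ω : Env) (lam : ℝ) (x : ℤ) :
    biasedLeft (shiftBy z ω) lam x = biasedLeft ω lam (x + z) := rfl

theorem biasedRight_shiftBy (z : ℤ) (ω : Env) (lam : ℝ) (x : ℤ) :
    biasedRight (shiftBy z ω) lam x = biasedRight ω lam (x + z) := rfl

theorem stepKernel_shiftBy (z : ℤ) (ω : Env) (lam : ℝ) (x y : ℤ) :
    stepKernel (shiftBy z ω) lam x {y} = stepKernel ω lam (x + z) {y + z} := by
  rw [stepKernel_singleton, stepKernel_singleton, biasedLeft_shiftBy, biasedRight_shiftBy]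
  congr 2
  · congr 1; exact propext ⟨fun h => by lia, fun h => by lia⟩
  · congr 1; exact propext ⟨fun h => by lia, fun h => by lia⟩

/-- The trajectory that starts at the origin, jumps by `s` and then follows the trajectory `Y`
translated by `s`. -/
def pathCons (s : ℤ) (Y : ℕ → ℤ) : ℕ → ℤ
  | 0 => 0
  | n + 1 => s + Y n

theorem measurable_pathCons (s : ℤ) : Measurable (pathCons s) := by
  refine measurable_pi_iff.2 fun n => ?_
  cases n with
  | zero => exact measurable_const
  | succ n => exact measurable_const.add (measurable_pi_apply n)

theorem pathCons_preimage_zero (s : ℤ) (x : ℕ → ℤ) :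
    pathCons s ⁻¹' pathCylinder 0 x = if x 0 = 0 then Set.univ else ∅ := by
  ext Y
  by_cases h : x 0 = 0
  · simp [pathCylinder, pathCons, h]
  · simp [pathCylinder, pathCons, h, Ne.symm h]

theorem pathCons_preimage_succ (s : ℤ) (n : ℕ) (x : ℕ → ℤ) :
    pathCons s ⁻¹' pathCylinder (n + 1) x =
      if x 0 = 0 then pathCylinder n (fun i => x (i + 1) - s) else ∅ := by
  ext Y
  have h1 : pathCons s Y ∈ pathCylinder (n + 1) x ↔
      x 0 = 0 ∧ Y ∈ pathCylinder n (fun i => x (i + 1) - s) := by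
    constructor
    · intro h
      refine ⟨(h 0 (Nat.zero_le _)).symm, fun i hi => ?_⟩
      have : s + Y i = x (i + 1) := h (i + 1) (by lia)
      lia
    · rintro ⟨h0, h⟩ i hi
      cases i with
      | zero => exact h0.symm
      | succ i =>
        have : Y i = x (i + 1) - s := h i (by lia)
        change s + Y i = _
        lia
  by_cases h : x 0 = 0
  · simp [h1, h]
  · simp [h1, h]

/-- The Markov property at time one: the walk jumps, and afterwards is a walk in the environment
seen from its new position. -/
theorem walkLaw_eq_first_step (ω : Env) (lam : ℝ) :
    walkLaw ω lam =
      ENNReal.ofReal (biasedLeft ω lam 0) •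
        (walkLaw (shiftBy (-1) ω) lam).map (pathCons (-1)) +
      ENNReal.ofReal (biasedRight ω lam 0) •
        (walkLaw (shiftBy 1 ω) lam).map (pathCons 1) := by
  have hm : ∀ s, IsProbabilityMeasure ((walkLaw (shiftBy s ω) lam).map (pathCons s)) := fun s =>
    Measure.isProbabilityMeasure_map (measurable_pathCons s).aemeasurable
  have h1 : ENNReal.ofReal (biasedLeft ω lam 0) + ENNReal.ofReal (biasedRight ω lam 0) = 1 := by
    rw [← ENNReal.ofReal_add (biasedLeft_nonneg ω lam 0) (biasedRight_nonneg ω lam 0),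
      biased_add, ENNReal.ofReal_one]
  have hp : IsProbabilityMeasure (ENNReal.ofReal (biasedLeft ω lam 0) •
        (walkLaw (shiftBy (-1) ω) lam).map (pathCons (-1)) +
      ENNReal.ofReal (biasedRight ω lam 0) •
        (walkLaw (shiftBy 1 ω) lam).map (pathCons 1)) := ⟨by
    have := hm 1; have := hm (-1)
    simp [h1]⟩
  symm
  refine eq_walkLaw (fun x => ?_) fun n x => ?_
  · simp only [Measure.add_apply, Measure.smul_apply, smul_eq_mul,
      Measure.map_apply (measurable_pathCons _) (measurableSet_pathCylinder _ _),
      pathCons_preimage_zero]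
    split_ifs <;> simp [h1]
  · simp only [Measure.add_apply, Measure.smul_apply, smul_eq_mul,
      Measure.map_apply (measurable_pathCons _) (measurableSet_pathCylinder _ _),
      pathCons_preimage_succ]
    by_cases hx : x 0 = 0
    swap
    · cases n with
      | zero => simp [pathCons_preimage_zero, hx]
      | succ n => simp [pathCons_preimage_succ, hx]
    cases n with
    | zero =>
      simp only [pathCons_preimage_zero, hx, if_true, measure_univ, mul_one, h1, one_mul,
        walkLaw_pathCylinder_zero, stepKernel_singleton, zero_add, zero_sub]
      congr 2
      · congr 1; exact propext ⟨fun h => by lia, fun h => by lia⟩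
      · congr 1; exact propext ⟨fun h => by lia, fun h => by lia⟩
    | succ n =>
      simp only [pathCons_preimage_succ, hx, if_true, walkLaw_pathCylinder_succ,
        stepKernel_shiftBy, add_mul, mul_assoc]
      congr 4 <;> simp

theorem lintegral_walkLaw (ω : Env) (lam : ℝ) {F : (ℕ → ℤ) → ENNReal} (hF : Measurable F) :
    ∫⁻ X, F X ∂walkLaw ω lam =
      ENNReal.ofReal (biasedLeft ω lam 0) *
        ∫⁻ Y, F (pathCons (-1) Y) ∂walkLaw (shiftBy (-1) ω) lam +
      ENNReal.ofReal (biasedRight ω lam 0) *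
        ∫⁻ Y, F (pathCons 1 Y) ∂walkLaw (shiftBy 1 ω) lam := by
  conv_lhs => rw [walkLaw_eq_first_step]
  rw [lintegral_add_measure, lintegral_smul_measure, lintegral_smul_measure,
    lintegral_map hF (measurable_pathCons _), lintegral_map hF (measurable_pathCons _)]
  rfl

theorem measurable_right (x : ℤ) : Measurable fun ω : Env => right ω x :=
  measurable_subtype_coe.comp (measurable_pi_apply x)

theorem measurable_left (x : ℤ) : Measurable fun ω : Env => left ω x :=
  measurable_const.sub (measurable_right x)

theorem measurable_biasedRight (lam : ℝ) (x : ℤ) : Measurable fun ω => biasedRight ω lam x :=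
  ((measurable_right x).mul_const _).div
    (((measurable_left x).mul_const _).add ((measurable_right x).mul_const _))

theorem measurable_biasedLeft (lam : ℝ) (x : ℤ) : Measurable fun ω => biasedLeft ω lam x :=
  ((measurable_left x).mul_const _).div
    (((measurable_left x).mul_const _).add ((measurable_right x).mul_const _))

theorem measurable_walkLaw (lam : ℝ) : Measurable fun ω => walkLaw ω lam := by
  refine Measurable.measure_of_isPiSystem_of_isProbabilityMeasure generateFrom_pathCylinders
    isPiSystem_pathCylinders ?_
  rintro _ ⟨n, x, rfl⟩
  induction n with
  | zero => simp only [walkLaw_pathCylinder_zero]; exact measurable_const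
  | succ n ih =>
    simp only [walkLaw_pathCylinder_succ, stepKernel_singleton]
    exact ih.mul (((measurable_biasedLeft lam _).ennreal_ofReal.mul_const _).add
      ((measurable_biasedRight lam _).ennreal_ofReal.mul_const _))

/-- The law of the walk as a Markov kernel from environments to trajectories. -/
noncomputable def walkKernel (lam : ℝ) : Kernel Env (ℕ → ℤ) where
  toFun ω := walkLaw ω lam
  measurable' := measurable_walkLaw lam

instance (lam : ℝ) : IsMarkovKernel (walkKernel lam) where
  isProbabilityMeasure ω := inferInstanceAs (IsProbabilityMeasure (walkLaw ω lam))

theorem walkKernel_apply (lam : ℝ) (ω : Env) : walkKernel lam ω = walkLaw ω lam := rfl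

/-! ### Additive functionals with nonpositive drift -/

/-- The additive functional `∑_{k<n} ψ(X_k, X_{k+1})` of a trajectory. -/
def additiveFunctional (ψ : ℤ → ℤ → ℝ) (n : ℕ) (X : ℕ → ℤ) : ℝ :=
  ∑ k ∈ Finset.range n, ψ (X k) (X (k + 1))

theorem measurable_additiveFunctional (ψ : ℤ → ℤ → ℝ) (n : ℕ) :
    Measurable (additiveFunctional ψ n) := by
  refine Finset.measurable_sum _ fun k _ => ?_
  have h : Measurable fun X : ℕ → ℤ => (X k, X (k + 1)) :=
    (measurable_pi_apply k).prodMk (measurable_pi_apply (k + 1))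
  exact (Measurable.of_discrete (f := fun p : ℤ × ℤ => ψ p.1 p.2)).comp h

theorem measurable_exp_additiveFunctional (θ : ℝ) (ψ : ℤ → ℤ → ℝ) (n : ℕ) :
    Measurable fun X => ENNReal.ofReal (Real.exp (θ * additiveFunctional ψ n X)) :=
  (Real.measurable_exp.comp ((measurable_additiveFunctional ψ n).const_mul θ)).ennreal_ofReal

theorem additiveFunctional_pathCons (ψ : ℤ → ℤ → ℝ) (n : ℕ) (s : ℤ) {Y : ℕ → ℤ} (hY : Y 0 = 0) :
    additiveFunctional ψ (n + 1) (pathCons s Y) =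
      ψ 0 s + additiveFunctional (fun x y => ψ (x + s) (y + s)) n Y := by
  rw [additiveFunctional, Finset.sum_range_succ', add_comm]
  simp [pathCons, hY, additiveFunctional, add_comm]

/-- An exponential moment bound, by induction on `n` through the Markov property at time one and
the inequality `exp y ≤ 1 + y + y ^ 2` for `|y| ≤ 1`. -/
theorem lintegral_exp_additiveFunctional_le (lam : ℝ) {C θ : ℝ} (hθ : 0 < θ) (hθC : θ * C ≤ 1)
    (n : ℕ) (ω : Env) (ψ : ℤ → ℤ → ℝ) (hψ : ∀ x, |ψ x (x - 1)| ≤ C ∧ |ψ x (x + 1)| ≤ C)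
    (hd : ∀ x, biasedLeft ω lam x * ψ x (x - 1) + biasedRight ω lam x * ψ x (x + 1) ≤ 0) :
    ∫⁻ X, ENNReal.ofReal (Real.exp (θ * additiveFunctional ψ n X)) ∂walkLaw ω lam ≤
      ENNReal.ofReal ((1 + (θ * C) ^ 2) ^ n) := by
  induction n generalizing ω ψ with
  | zero => simp [additiveFunctional]
  | succ n ih =>
    have step : ∀ s : ℤ, ∫⁻ Y, ENNReal.ofReal
          (Real.exp (θ * additiveFunctional ψ (n + 1) (pathCons s Y))) ∂walkLaw (shiftBy s ω) lam ≤
        ENNReal.ofReal (Real.exp (θ * ψ 0 s)) * ENNReal.ofReal ((1 + (θ * C) ^ 2) ^ n) := by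
      intro s
      have h1 := ih (shiftBy s ω) (fun x y => ψ (x + s) (y + s))
        (fun x => by
          rw [show x - 1 + s = x + s - 1 by ring, show x + 1 + s = x + s + 1 by ring]
          exact hψ (x + s))
        (fun x => by
          rw [biasedLeft_shiftBy, biasedRight_shiftBy,
            show x - 1 + s = x + s - 1 by ring, show x + 1 + s = x + s + 1 by ring]
          exact hd (x + s))
      refine le_trans (le_of_eq ?_) (mul_le_mul_right h1 (ENNReal.ofReal (Real.exp (θ * ψ 0 s))))
      rw [← lintegral_const_mul _ (measurable_exp_additiveFunctional θ _ n)]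
      refine lintegral_congr_ae ?_
      filter_upwards [ae_walkLaw_zero (shiftBy s ω) lam] with Y hY
      rw [additiveFunctional_pathCons ψ n s hY, mul_add, Real.exp_add,
        ENNReal.ofReal_mul (Real.exp_pos _).le]
    rw [lintegral_walkLaw ω lam (measurable_exp_additiveFunctional θ ψ (n + 1))]
    have hexp : ∀ s, |ψ 0 s| ≤ C → Real.exp (θ * ψ 0 s) ≤ 1 + θ * ψ 0 s + (θ * C) ^ 2 := by
      intro s hs
      have h1 : |θ * ψ 0 s| ≤ θ * C := by
        rw [abs_mul, abs_of_pos hθ]; exact mul_le_mul_of_nonneg_left hs hθ.le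
      have h2 := (abs_le.1 (Real.abs_exp_sub_one_sub_id_le (h1.trans hθC))).2
      have h3 : (θ * ψ 0 s) ^ 2 ≤ (θ * C) ^ 2 := sq_le_sq' (abs_le.1 h1).1 (abs_le.1 h1).2
      linarith
    have hl := biasedLeft_nonneg ω lam 0
    have hr := biasedRight_nonneg ω lam 0
    have hreal : biasedLeft ω lam 0 * (Real.exp (θ * ψ 0 (-1)) * (1 + (θ * C) ^ 2) ^ n) +
        biasedRight ω lam 0 * (Real.exp (θ * ψ 0 1) * (1 + (θ * C) ^ 2) ^ n) ≤
        (1 + (θ * C) ^ 2) ^ (n + 1) := by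
      have h0 : biasedLeft ω lam 0 * Real.exp (θ * ψ 0 (-1)) +
          biasedRight ω lam 0 * Real.exp (θ * ψ 0 1) ≤ 1 + (θ * C) ^ 2 := by
        have e1 := mul_le_mul_of_nonneg_left (hexp (-1) (by simpa using (hψ 0).1)) hl
        have e2 := mul_le_mul_of_nonneg_left (hexp 1 (by simpa using (hψ 0).2)) hr
        have e3 := biased_add ω lam 0
        have e4 := hd 0
        simp only [zero_sub, zero_add] at e4
        have e5 := mul_le_mul_of_nonneg_left e4 hθ.le
        calc _ ≤ _ := add_le_add e1 e2
          _ = (biasedLeft ω lam 0 + biasedRight ω lam 0) * (1 + (θ * C) ^ 2) +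
              θ * (biasedLeft ω lam 0 * ψ 0 (-1) + biasedRight ω lam 0 * ψ 0 1) := by ring
          _ ≤ _ := by rw [e3]; linarith
      calc _ = (biasedLeft ω lam 0 * Real.exp (θ * ψ 0 (-1)) +
          biasedRight ω lam 0 * Real.exp (θ * ψ 0 1)) * (1 + (θ * C) ^ 2) ^ n := by ring
        _ ≤ (1 + (θ * C) ^ 2) * (1 + (θ * C) ^ 2) ^ n := by gcongr
        _ = _ := by ring
    calc _ ≤ ENNReal.ofReal (biasedLeft ω lam 0) *
            (ENNReal.ofReal (Real.exp (θ * ψ 0 (-1))) * ENNReal.ofReal ((1 + (θ * C) ^ 2) ^ n)) +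
          ENNReal.ofReal (biasedRight ω lam 0) *
            (ENNReal.ofReal (Real.exp (θ * ψ 0 1)) * ENNReal.ofReal ((1 + (θ * C) ^ 2) ^ n)) := by
          gcongr
          exacts [step (-1), step 1]
      _ = ENNReal.ofReal (biasedLeft ω lam 0 * (Real.exp (θ * ψ 0 (-1)) * (1 + (θ * C) ^ 2) ^ n) +
        biasedRight ω lam 0 * (Real.exp (θ * ψ 0 1) * (1 + (θ * C) ^ 2) ^ n)) := by
          rw [ENNReal.ofReal_add (by positivity) (by positivity), ENNReal.ofReal_mul hl,
            ENNReal.ofReal_mul hr, ENNReal.ofReal_mul (Real.exp_pos _).le,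
            ENNReal.ofReal_mul (Real.exp_pos _).le]
      _ ≤ _ := ENNReal.ofReal_le_ofReal hreal

/-- An additive functional with bounded increments and nonpositive drift is at most `o(n)`. -/
theorem ae_eventually_additiveFunctional_le (ω : Env) (lam : ℝ) {ψ : ℤ → ℤ → ℝ} {C : ℝ}
    (hψ : ∀ x, |ψ x (x - 1)| ≤ C ∧ |ψ x (x + 1)| ≤ C)
    (hd : ∀ x, biasedLeft ω lam x * ψ x (x - 1) + biasedRight ω lam x * ψ x (x + 1) ≤ 0)
    {ε : ℝ} (hε : 0 < ε) :
    ∀ᵐ X ∂walkLaw ω lam, ∀ᶠ n : ℕ in atTop, additiveFunctional ψ n X ≤ ε * n := by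
  wlog hC : 1 ≤ C generalizing C
  · exact this (C := max C 1) 
      (fun x => ⟨(hψ x).1.trans (le_max_left _ _), (hψ x).2.trans (le_max_left _ _)⟩)
      (le_max_right _ _)
  have hC0 : 0 < C := by linarith
  -- a rate small enough that `(θ C)² < θ ε`
  set θ := min 1 (ε / 2) / C ^ 2 with hθdef
  have hθ : 0 < θ := by positivity
  have hθC2 : θ * C ^ 2 = min 1 (ε / 2) := by rw [hθdef]; field_simp
  have hθC : θ * C ≤ 1 := by
    have h1 : θ * C ^ 2 ≤ 1 := hθC2 ▸ min_le_left _ _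
    nlinarith [mul_pos hθ hC0]
  have hθε : (θ * C) ^ 2 - θ * ε < 0 := by
    have h1 : θ * C ^ 2 ≤ ε / 2 := hθC2 ▸ min_le_right _ _
    nlinarith
  set r := Real.exp ((θ * C) ^ 2 - θ * ε) with hr
  have hr1 : r < 1 := Real.exp_lt_one_iff.2 hθε
  have hbound : ∀ n : ℕ, walkLaw ω lam {X | ε * n < additiveFunctional ψ n X} ≤
      ENNReal.ofReal (r ^ n) := by
    intro n
    have h1 := mul_meas_ge_le_lintegral (μ := walkLaw ω lam)
      (measurable_exp_additiveFunctional θ ψ n)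
      (ENNReal.ofReal (Real.exp (θ * (ε * n))))
    have h2 := h1.trans (lintegral_exp_additiveFunctional_le lam hθ hθC n ω ψ hψ hd)
    have h3 : walkLaw ω lam {X | ε * n < additiveFunctional ψ n X} ≤
        ENNReal.ofReal ((1 + (θ * C) ^ 2) ^ n) / ENNReal.ofReal (Real.exp (θ * (ε * n))) := by
      rw [ENNReal.le_div_iff_mul_le (Or.inl (by positivity)) (Or.inl ENNReal.ofReal_ne_top),
        mul_comm]
      refine le_trans (mul_le_mul_right (measure_mono fun X hX => ?_) _) h2
      have hX' : ε * n < additiveFunctional ψ n X := hX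
      exact ENNReal.ofReal_le_ofReal (Real.exp_le_exp.2 (by gcongr))
    refine h3.trans ?_
    rw [← ENNReal.ofReal_div_of_pos (Real.exp_pos _)]
    refine ENNReal.ofReal_le_ofReal ?_
    rw [div_le_iff₀ (Real.exp_pos _), hr, ← Real.exp_nat_mul, ← Real.exp_add,
      show n * ((θ * C) ^ 2 - θ * ε) + θ * (ε * n) = n * (θ * C) ^ 2 by ring, Real.exp_nat_mul]
    gcongr
    rw [add_comm]; exact Real.add_one_le_exp _
  have hsum : ∑' n : ℕ, walkLaw ω lam {X | ε * n < additiveFunctional ψ n X} ≠ ⊤ := by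
    refine ne_top_of_le_ne_top ?_ (ENNReal.tsum_le_tsum hbound)
    exact (summable_geometric_of_lt_one (Real.exp_pos _).le hr1).tsum_ofReal_ne_top
  filter_upwards [ae_eventually_notMem hsum] with X hX
  filter_upwards [hX] with n hn
  exact not_lt.1 hn

/-! ### Stationarity and the moments of the environment -/

/-- The shift of environments by `z` as a measurable equivalence. -/
def shiftEquiv (z : ℤ) : Env ≃ᵐ Env where
  toFun := shiftBy z
  invFun := shiftBy (-z)
  left_inv ω := by rw [shiftBy_shiftBy, neg_add_cancel, shiftBy_zero]
  right_inv ω := by rw [shiftBy_shiftBy, add_neg_cancel, shiftBy_zero]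
  measurable_toFun := measurable_shiftBy z
  measurable_invFun := measurable_shiftBy (-z)

theorem shift_iterate (n : ℕ) (ω : Env) : shift^[n] ω = shiftBy n ω := by
  induction n with
  | zero => exact (shiftBy_zero ω).symm
  | succ n ih =>
    rw [Function.iterate_succ_apply', ih]
    exact (shiftBy_shiftBy 1 n ω).trans (by rw [add_comm]; norm_cast)

theorem measurePreserving_shiftBy {P : Measure Env} (hP : MeasurePreserving shift P P) (z : ℤ) :
    MeasurePreserving (shiftBy z) P P := by
  have hnat : ∀ n : ℕ, MeasurePreserving (shiftBy n) P P := fun n => by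
    have := hP.iterate n
    rwa [funext (shift_iterate n)] at this
  rcases Int.eq_nat_or_neg z with ⟨n, rfl | rfl⟩
  · exact hnat n
  · exact MeasurePreserving.symm (shiftEquiv n) (hnat n)

theorem biasedRight_pos (ω : Env) (lam : ℝ) (x : ℤ) : 0 < biasedRight ω lam x :=
  div_pos (mul_pos (right_pos ω x) (Real.exp_pos _)) (weight_pos ω lam x)

theorem biasedLeft_pos (ω : Env) (lam : ℝ) (x : ℤ) : 0 < biasedLeft ω lam x :=
  div_pos (mul_pos (left_pos ω x) (Real.exp_pos _)) (weight_pos ω lam x)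

/-- The ratio `ω_x^-(lam) / ω_x^+(lam)` of the biased jump probabilities. -/
noncomputable def biasedRho (ω : Env) (lam : ℝ) (x : ℤ) : ℝ := rho ω x * Real.exp (-(2 * lam))

theorem rho_pos (ω : Env) (x : ℤ) : 0 < rho ω x := div_pos (left_pos ω x) (right_pos ω x)

theorem biasedRho_pos (ω : Env) (lam : ℝ) (x : ℤ) : 0 < biasedRho ω lam x :=
  mul_pos (rho_pos ω x) (Real.exp_pos _)

theorem biasedRho_shiftBy (z : ℤ) (ω : Env) (lam : ℝ) (x : ℤ) :
    biasedRho (shiftBy z ω) lam x = biasedRho ω lam (x + z) := rfl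

theorem biasedLeft_eq (ω : Env) (lam : ℝ) (x : ℤ) :
    biasedLeft ω lam x = biasedRho ω lam x * biasedRight ω lam x := by
  have h1 := (right_pos ω x).ne'
  have h2 : Real.exp (-lam) = Real.exp (-(2 * lam)) * Real.exp lam := by
    rw [← Real.exp_add]; congr 1; ring1
  rw [biasedLeft, biasedRho, rho, biasedRight, h2]
  field_simp

theorem biasedRight_mul_one_add (ω : Env) (lam : ℝ) (x : ℤ) :
    biasedRight ω lam x * (1 + biasedRho ω lam x) = 1 := by
  linear_combination biased_add ω lam x - biasedLeft_eq ω lam x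

theorem measurable_biasedRho (lam : ℝ) (x : ℤ) : Measurable fun ω => biasedRho ω lam x :=
  ((measurable_left x).div (measurable_right x)).mul_const _

/-- The moment `E[ρ_0(lam) ⋯ ρ_{i-1}(lam)]` of the biased environment. -/
noncomputable def rhoMoment (P : Measure Env) (lam : ℝ) (i : ℕ) : ENNReal :=
  ∫⁻ ω, ∏ j ∈ Finset.range i, ENNReal.ofReal (biasedRho ω lam j) ∂P

/-- The annealed mean `∑_i E[(1 + ρ_i(lam)) ρ_0(lam) ⋯ ρ_{i-1}(lam)]` of the time that the biased
walk needs to reach `1` from `0`. -/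
noncomputable def meanPassage (P : Measure Env) (lam : ℝ) : ENNReal :=
  ∑' i, (rhoMoment P lam i + rhoMoment P lam (i + 1))

theorem measurable_prod_biasedRho (lam : ℝ) (i : ℕ) (x : ℕ → ℤ) :
    Measurable fun ω => ∏ j ∈ Finset.range i, ENNReal.ofReal (biasedRho ω lam (x j)) :=
  Finset.measurable_prod _ fun _ _ => (measurable_biasedRho lam _).ennreal_ofReal

theorem rhoMoment_zero (P : Measure Env) [IsProbabilityMeasure P] (lam : ℝ) :
    rhoMoment P lam 0 = 1 := by simp [rhoMoment]

theorem one_le_meanPassage (P : Measure Env) [IsProbabilityMeasure P] (lam : ℝ) :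
    1 ≤ meanPassage P lam := by
  refine le_trans ?_ (ENNReal.le_tsum 0)
  rw [rhoMoment_zero]; exact le_self_add

theorem lintegral_prod_biasedRho {P : Measure Env} (hP : MeasurePreserving shift P P) (lam : ℝ)
    (z : ℤ) (i : ℕ) :
    ∫⁻ ω, ∏ j ∈ Finset.range i, ENNReal.ofReal (biasedRho ω lam (j + z)) ∂P =
      rhoMoment P lam i :=
  (measurePreserving_shiftBy hP z).lintegral_comp (measurable_prod_biasedRho lam i fun j => j)

theorem lintegral_prod_biasedRho_neg {P : Measure Env} (hP : MeasurePreserving shift P P)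
    (lam : ℝ) (i : ℕ) :
    ∫⁻ ω, ∏ j ∈ Finset.range i, ENNReal.ofReal (biasedRho ω lam (-j)) ∂P =
      rhoMoment P lam i := by
  rw [← lintegral_prod_biasedRho hP lam (1 - i) i]
  refine lintegral_congr fun ω => ?_
  rw [← Finset.prod_range_reflect]
  refine Finset.prod_congr rfl fun j hj => ?_
  congr 2
  have := Finset.mem_range.1 hj
  lia

/-! ### The passage time truncated in space and in size -/

/-- The quenched mean of the time to reach `1` from `0`, when the passages from `-n` to `1 - n` take
no time. -/
noncomputable def passageMean (lam : ℝ) : ℕ → Env → ℝ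
  | 0, _ => 0
  | n + 1, ω => (1 + biasedLeft ω lam 0 * passageMean lam n (shiftBy (-1) ω)) / biasedRight ω lam 0

/-- The recursion of `passageMean`, truncated at the level `C`. Monotone in `n`, it is a bounded
solution of the inequality `ω_0^+(lam) t - ω_0^-(lam) (t ∘ θ⁻¹) ≤ 1`. -/
noncomputable def truncPassage (lam C : ℝ) : ℕ → Env → ℝ
  | 0, _ => 0
  | n + 1, ω => min C
      ((1 + biasedLeft ω lam 0 * truncPassage lam C n (shiftBy (-1) ω)) / biasedRight ω lam 0)

/-- The solution of the recursion is the sum of the first `n` terms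
`(1 + ρ_{-i}) ρ_0 ⋯ ρ_{1-i}`. -/
theorem passageMean_eq (lam : ℝ) (n : ℕ) (ω : Env) :
    passageMean lam n ω = ∑ i ∈ Finset.range n,
      (∏ j ∈ Finset.range i, biasedRho ω lam (-j) +
        ∏ j ∈ Finset.range (i + 1), biasedRho ω lam (-j)) := by
  have hstep : ∀ (ω : Env) (i : ℕ), ∏ j ∈ Finset.range (i + 1), biasedRho ω lam (-j) =
      biasedRho ω lam 0 * ∏ j ∈ Finset.range i, biasedRho (shiftBy (-1) ω) lam (-j) := fun ω i => by
    rw [Finset.prod_range_succ', mul_comm]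
    congr 1
    refine Finset.prod_congr rfl fun j _ => ?_
    rw [biasedRho_shiftBy]; congr 1; push_cast; ring1
  induction n generalizing ω with
  | zero => simp [passageMean]
  | succ n ih =>
    have hp := (biasedRight_pos ω lam 0).ne'
    have h1 := biasedRight_mul_one_add ω lam 0
    rw [passageMean, ih, Finset.sum_range_succ', div_eq_iff hp, biasedLeft_eq]
    simp only [hstep ω, Finset.range_zero, Finset.prod_empty, ← mul_add, ← Finset.mul_sum]
    linear_combination -h1

theorem lintegral_passageMean {P : Measure Env} (hP : MeasurePreserving shift P P) (lam : ℝ)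
    (n : ℕ) : ∫⁻ ω, ENNReal.ofReal (passageMean lam n ω) ∂P =
      ∑ i ∈ Finset.range n, (rhoMoment P lam i + rhoMoment P lam (i + 1)) := by
  have hD : ∀ i (ω : Env), 0 ≤ ∏ j ∈ Finset.range i, biasedRho ω lam (-j) := fun i ω =>
    Finset.prod_nonneg fun j _ => (biasedRho_pos ω lam _).le
  have h : ∀ ω, ENNReal.ofReal (passageMean lam n ω) = ∑ i ∈ Finset.range n,
      (∏ j ∈ Finset.range i, ENNReal.ofReal (biasedRho ω lam (-j)) +
        ∏ j ∈ Finset.range (i + 1), ENNReal.ofReal (biasedRho ω lam (-j))) := fun ω => by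
    rw [passageMean_eq, ENNReal.ofReal_sum_of_nonneg fun i _ => add_nonneg (hD _ _) (hD _ _)]
    refine Finset.sum_congr rfl fun i _ => ?_
    rw [ENNReal.ofReal_add (hD _ _) (hD _ _),
      ENNReal.ofReal_prod_of_nonneg fun j _ => (biasedRho_pos ω lam _).le,
      ENNReal.ofReal_prod_of_nonneg fun j _ => (biasedRho_pos ω lam _).le]
  simp only [h]
  have hm : ∀ i, Measurable fun ω => ∏ j ∈ Finset.range i, ENNReal.ofReal (biasedRho ω lam (-j)) :=
    fun i => measurable_prod_biasedRho lam i fun j => -j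
  rw [lintegral_finsetSum _ fun i _ => by exact (hm i).add (hm (i + 1))]
  refine Finset.sum_congr rfl fun i _ => ?_
  rw [lintegral_add_left (hm i), lintegral_prod_biasedRho_neg hP, lintegral_prod_biasedRho_neg hP]

theorem measurable_truncPassage (lam C : ℝ) (n : ℕ) : Measurable (truncPassage lam C n) := by
  induction n with
  | zero => exact measurable_const
  | succ n ih =>
    exact measurable_const.min ((measurable_const.add ((measurable_biasedLeft lam 0).mul
      (ih.comp (measurable_shiftBy (-1))))).div (measurable_biasedRight lam 0))

theorem truncPassage_nonneg (lam : ℝ) {C : ℝ} (hC : 0 ≤ C) (n : ℕ) (ω : Env) :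
    0 ≤ truncPassage lam C n ω := by
  induction n generalizing ω with
  | zero => exact le_rfl
  | succ n ih =>
    exact le_min hC (div_nonneg (add_nonneg zero_le_one
      (mul_nonneg (biasedLeft_nonneg _ _ _) (ih _))) (biasedRight_nonneg _ _ _))

theorem truncPassage_le (lam : ℝ) {C : ℝ} (hC : 0 ≤ C) (n : ℕ) (ω : Env) :
    truncPassage lam C n ω ≤ C := by
  cases n with
  | zero => exact hC
  | succ n => exact min_le_left _ _

theorem truncPassage_le_succ (lam : ℝ) {C : ℝ} (hC : 0 ≤ C) (n : ℕ) (ω : Env) :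
    truncPassage lam C n ω ≤ truncPassage lam C (n + 1) ω := by
  induction n generalizing ω with
  | zero => exact truncPassage_nonneg lam hC 1 ω
  | succ n ih =>
    refine min_le_min_left _ ?_
    have := biasedRight_pos ω lam 0
    have := biasedLeft_pos ω lam 0
    gcongr
    exact ih _

theorem truncPassage_drift (lam : ℝ) {C : ℝ} (hC : 0 ≤ C) (n : ℕ) (ω : Env) :
    biasedRight ω lam 0 * truncPassage lam C n ω -
      biasedLeft ω lam 0 * truncPassage lam C n (shiftBy (-1) ω) ≤ 1 := by
  have h1 := (truncPassage_le_succ lam hC n ω).trans (min_le_right _ _)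
  rw [le_div_iff₀ (biasedRight_pos ω lam 0)] at h1
  linarith

theorem tendsto_truncPassage (lam : ℝ) (n : ℕ) (ω : Env) :
    Tendsto (fun C : ℕ => truncPassage lam C n ω) atTop (𝓝 (passageMean lam n ω)) := by
  induction n generalizing ω with
  | zero => exact tendsto_const_nhds
  | succ n ih =>
    have h := (((ih (shiftBy (-1) ω)).const_mul (biasedLeft ω lam 0)).const_add 1).div_const
      (biasedRight ω lam 0)
    refine h.congr' ?_
    filter_upwards [h.eventually_lt_const (lt_add_one _),
      tendsto_natCast_atTop_atTop.eventually_ge_atTop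
      ((1 + biasedLeft ω lam 0 * passageMean lam n (shiftBy (-1) ω)) / biasedRight ω lam 0 + 1)]
      with C h1 h2
    exact (min_eq_right (h1.le.trans h2)).symm

/-- The mean of the truncated passage time approaches `meanPassage`. -/
theorem exists_lt_integral_truncPassage {P : Measure Env} [IsProbabilityMeasure P]
    (hP : MeasurePreserving shift P P) (lam : ℝ) {K : ℝ}
    (hK : ENNReal.ofReal K < meanPassage P lam) :
    ∃ (C : ℕ) (n : ℕ), K < ∫ ω, truncPassage lam C n ω ∂P := by
  rw [meanPassage, ENNReal.tsum_eq_iSup_nat, lt_iSup_iff] at hK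
  obtain ⟨n, hn⟩ := hK
  rw [← lintegral_passageMean hP] at hn
  have h1 : ∫⁻ ω, ENNReal.ofReal (passageMean lam n ω) ∂P ≤
      liminf (fun C : ℕ => ∫⁻ ω, ENNReal.ofReal (truncPassage lam C n ω) ∂P) atTop := by
    refine le_trans (le_of_eq (lintegral_congr fun ω => ?_))
      (lintegral_liminf_le fun C => (measurable_truncPassage lam C n).ennreal_ofReal)
    exact (ENNReal.tendsto_ofReal (tendsto_truncPassage lam n ω)).liminf_eq.symm
  obtain ⟨C, hC⟩ := (eventually_lt_of_lt_liminf (hn.trans_le h1)).exists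
  refine ⟨C, n, ?_⟩
  have hC0 : (0 : ℝ) ≤ C := Nat.cast_nonneg C
  rw [← ofReal_integral_eq_lintegral_ofReal
    (Integrable.of_bound (measurable_truncPassage lam C n).aestronglyMeasurable C
      (ae_of_all _ fun ω => by
        rw [Real.norm_of_nonneg (truncPassage_nonneg lam hC0 n ω)]
        exact truncPassage_le lam hC0 n ω))
    (ae_of_all _ fun ω => truncPassage_nonneg lam hC0 n ω)] at hC
  exact (ENNReal.ofReal_lt_ofReal_iff').1 hC |>.1

/-! ### The upper bound on the speed -/

/-- The primitive `Φ` of `τ`, with `Φ 0 = 0` and `Φ (x + 1) = Φ x + τ x`. -/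
noncomputable def primitive (τ : ℤ → ℝ) (x : ℤ) : ℝ :=
  ∑ k ∈ Finset.range x.toNat, τ k - ∑ k ∈ Finset.range (-x).toNat, τ (-k - 1)

theorem primitive_add_one (τ : ℤ → ℝ) (x : ℤ) : primitive τ (x + 1) = primitive τ x + τ x := by
  rcases le_or_gt 0 x with h | h
  · obtain ⟨n, rfl⟩ := Int.eq_ofNat_of_zero_le h
    have h1 : ((n : ℤ) + 1).toNat = n + 1 := by lia
    have h2 : (-((n : ℤ) + 1)).toNat = 0 := by lia
    have h3 : (-(n : ℤ)).toNat = 0 := by lia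
    rw [primitive, primitive, h1, h2, h3, Finset.sum_range_succ]
    simp
  · obtain ⟨n, hn⟩ := Int.eq_ofNat_of_zero_le (show 0 ≤ -x - 1 by lia)
    have h1 : (x + 1).toNat = 0 := by lia
    have h2 : (-(x + 1)).toNat = n := by lia
    have h3 : (-x).toNat = n + 1 := by lia
    have h4 : x.toNat = 0 := by lia
    rw [primitive, primitive, h1, h2, h3, h4, Finset.sum_range_succ, show -(n : ℤ) - 1 = x by lia]
    simp

theorem primitive_natCast (τ : ℤ → ℝ) (n : ℕ) :
    primitive τ n = ∑ k ∈ Finset.range n, τ k := by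
  simp [primitive]

/-- If `τ` is bounded, `ω_x^+(lam) τ x - ω_x^-(lam) τ (x - 1) ≤ 1`, and the averages of `τ` to the
right are at least `K`, then the walk has speed at most `1 / K`: the drift of `Φ(X_n) - n` is
nonpositive, where `Φ` is the primitive of `τ`. -/
theorem ae_eventually_mul_le_of_drift (ω : Env) (lam : ℝ) {τ : ℤ → ℝ} {C K K' : ℝ}
    (hτ : ∀ x, |τ x| ≤ C)
    (hd : ∀ x, biasedRight ω lam x * τ x - biasedLeft ω lam x * τ (x - 1) ≤ 1)
    (hK : ∀ᶠ n : ℕ in atTop, K * n ≤ ∑ k ∈ Finset.range n, τ k) (hK' : 0 < K') (hKK : K' < K) :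
    ∀ᵐ X ∂walkLaw ω lam, ∀ᶠ n : ℕ in atTop, K' * X n ≤ n := by
  set ψ : ℤ → ℤ → ℝ := fun x y => primitive τ y - primitive τ x - 1 with hψdef
  have hr : ∀ x, ψ x (x + 1) = τ x - 1 := fun x => by
    simp only [hψdef, primitive_add_one]; ring1
  have hl : ∀ x, ψ x (x - 1) = -τ (x - 1) - 1 := fun x => by
    have := primitive_add_one τ (x - 1)
    rw [sub_add_cancel] at this
    simp only [hψdef]; linarith
  have hε : 0 < K / K' - 1 := by rw [sub_pos, one_lt_div hK']; exact hKK
  have hsum : ∀ X : ℕ → ℤ, X 0 = 0 → ∀ n : ℕ,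
      additiveFunctional ψ n X = primitive τ (X n) - n := fun X hX n => by
    simp only [additiveFunctional, hψdef]
    rw [Finset.sum_sub_distrib, Finset.sum_range_sub (fun k => primitive τ (X k)), hX]
    simp [primitive]
  have key := ae_eventually_additiveFunctional_le ω lam (ψ := ψ) (C := C + 1) (fun x => by
      rw [hr, hl]
      have h1 := abs_le.1 (hτ x)
      have h2 := abs_le.1 (hτ (x - 1))
      exact ⟨abs_le.2 ⟨by linarith, by linarith⟩, abs_le.2 ⟨by linarith, by linarith⟩⟩)
    (fun x => by
      rw [hr, hl]
      have h1 := hd x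
      have h2 := biased_add ω lam x
      linarith) hε
  obtain ⟨N, hN⟩ := eventually_atTop.1 hK
  filter_upwards [key, ae_walkLaw_zero ω lam] with X hX hX0
  filter_upwards [hX, tendsto_natCast_atTop_atTop.eventually_ge_atTop (K' * N)] with n hn hn'
  rw [hsum X hX0] at hn
  rcases le_or_gt (N : ℤ) (X n) with h | h
  · obtain ⟨m, hm⟩ := Int.eq_ofNat_of_zero_le ((Int.natCast_nonneg N).trans h)
    rw [hm] at hn h ⊢
    rw [primitive_natCast] at hn
    have h1 := hN m (by exact_mod_cast h)
    have h2 : K * m ≤ K / K' * n := by linarith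
    rw [div_mul_eq_mul_div, le_div_iff₀ hK'] at h2
    have : K * (K' * m) ≤ K * n := by linarith
    exact_mod_cast le_of_mul_le_mul_left this (hK'.trans hKK)
  · refine le_trans ?_ hn'
    gcongr
    exact_mod_cast h.le

/-- For `K` below the mean passage time, the drift criterion applies to a truncated passage time
with mean above `K`. -/
theorem ae_eventually_mul_le {P : Measure Env} [IsProbabilityMeasure P] (hP : Ergodic shift P)
    (lam : ℝ) {K : ℝ} (hK0 : 0 < K) (hK : ENNReal.ofReal K < meanPassage P lam) :
    ∀ᵐ ω ∂P, ∀ᵐ X ∂walkLaw ω lam, ∀ᶠ n : ℕ in atTop, K * X n ≤ n := by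
  obtain ⟨C, m, hC⟩ := exists_lt_integral_truncPassage hP.toMeasurePreserving lam hK
  obtain ⟨K₁, h1, h2⟩ := exists_between hC
  have hC0 : (0 : ℝ) ≤ C := Nat.cast_nonneg C
  have hb : ∀ ω, |truncPassage lam C m ω| ≤ C := fun ω => by
    rw [abs_of_nonneg (truncPassage_nonneg lam hC0 m ω)]
    exact truncPassage_le lam hC0 m ω
  filter_upwards [ae_eventually_le_birkhoffSum hP (measurable_truncPassage lam C m) hb h2]
    with ω hω
  refine ae_eventually_mul_le_of_drift ω lam (τ := fun x => truncPassage lam C m (shiftBy x ω))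
    (K := K₁) (fun x => hb _) (fun x => ?_) ?_ hK0 h1
  · have := truncPassage_drift lam hC0 m (shiftBy x ω)
    rw [biasedLeft_shiftBy, biasedRight_shiftBy, zero_add, shiftBy_shiftBy, neg_add_eq_sub] at this
    exact this
  · filter_upwards [hω] with n hn
    simpa only [birkhoffSum, shift_iterate] using hn

/-- The walk has asymptotic speed at most `1 / meanPassage`. -/
theorem ae_eventually_le_speed {P : Measure Env} [IsProbabilityMeasure P] (hP : Ergodic shift P)
    (lam : ℝ) {ε : ℝ} (hε : 0 < ε) :
    ∀ᵐ ω ∂P, ∀ᵐ X ∂walkLaw ω lam, ∀ᶠ n : ℕ in atTop,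
      (X n : ℝ) ≤ ((meanPassage P lam)⁻¹.toReal + ε) * n := by
  set c := (meanPassage P lam)⁻¹.toReal with hc
  have hc0 : 0 ≤ c := ENNReal.toReal_nonneg
  have hK0 : 0 < (c + ε)⁻¹ := by positivity
  have hK : ENNReal.ofReal (c + ε)⁻¹ < meanPassage P lam := by
    rw [ENNReal.ofReal_inv_of_pos (by positivity), ENNReal.inv_lt_iff_inv_lt,
      ENNReal.lt_ofReal_iff_toReal_lt (ENNReal.inv_ne_top.2
        (zero_lt_one.trans_le (one_le_meanPassage P lam)).ne')]
    linarith
  filter_upwards [ae_eventually_mul_le hP lam hK0 hK] with ω hω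
  filter_upwards [hω] with X hX
  filter_upwards [hX] with n hn
  rwa [inv_mul_le_iff₀ (by positivity)] at hn

/-! ### The invariant measure of the environment seen from the walk -/

/-- The series `∑_i ρ_1(lam) ⋯ ρ_i(lam)`. -/
noncomputable def forwardSeries (lam : ℝ) (ω : Env) : ENNReal :=
  ∑' i : ℕ, ∏ j ∈ Finset.range i, ENNReal.ofReal (biasedRho ω lam (j + 1))

theorem measurable_forwardSeries (lam : ℝ) : Measurable (forwardSeries lam) :=
  Measurable.tsum fun i => measurable_prod_biasedRho lam i fun j => j + 1

theorem forwardSeries_eq (lam : ℝ) (ω : Env) :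
    forwardSeries lam ω =
      1 + ENNReal.ofReal (biasedRho ω lam 1) * forwardSeries lam (shiftBy 1 ω) := by
  rw [forwardSeries, tsum_eq_zero_add' ENNReal.summable, forwardSeries,
    ← ENNReal.tsum_mul_left]
  simp only [Finset.range_zero, Finset.prod_empty]
  congr 1
  refine tsum_congr fun i => ?_
  rw [Finset.prod_range_succ', mul_comm]
  congr 1

/-- The density with respect to `P` of the (unnormalized) invariant measure of the environment
seen from the walk. -/
noncomputable def invDensity (lam : ℝ) (ω : Env) : ENNReal :=
  forwardSeries lam ω + ENNReal.ofReal (biasedRho ω lam 0) * forwardSeries lam ω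

theorem measurable_invDensity (lam : ℝ) : Measurable (invDensity lam) :=
  (measurable_forwardSeries lam).add
    ((measurable_biasedRho lam 0).ennreal_ofReal.mul (measurable_forwardSeries lam))

theorem invDensity_ne_zero (lam : ℝ) (ω : Env) : invDensity lam ω ≠ 0 := by
  rw [invDensity, forwardSeries_eq]
  simp

theorem invDensity_mul_right (lam : ℝ) (ω : Env) :
    invDensity lam ω * ENNReal.ofReal (biasedRight ω lam 0) = forwardSeries lam ω := by
  have h := biasedRight_mul_one_add ω lam 0
  have hr := (biasedRho_pos ω lam 0).le
  have h' : (1 + ENNReal.ofReal (biasedRho ω lam 0)) *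
      ENNReal.ofReal (biasedRight ω lam 0) = 1 := by
    rw [← ENNReal.ofReal_one, ← ENNReal.ofReal_add zero_le_one hr,
      ← ENNReal.ofReal_mul (by positivity), mul_comm, h]
  calc _ = forwardSeries lam ω * ((1 + ENNReal.ofReal (biasedRho ω lam 0)) *
        ENNReal.ofReal (biasedRight ω lam 0)) := by rw [invDensity]; ring
    _ = _ := by rw [h', mul_one]

theorem invDensity_mul_left (lam : ℝ) (ω : Env) :
    invDensity lam ω * ENNReal.ofReal (biasedLeft ω lam 0) =
      ENNReal.ofReal (biasedRho ω lam 0) * forwardSeries lam ω := by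
  rw [biasedLeft_eq, ENNReal.ofReal_mul (biasedRho_pos ω lam 0).le, mul_left_comm,
    invDensity_mul_right]

/-- Invariance of the density: the mass carried to `ω` from the environments seen from the two
neighbouring sites. -/
theorem invDensity_eq (lam : ℝ) (ω : Env) :
    forwardSeries lam (shiftBy (-1) ω) +
      ENNReal.ofReal (biasedRho ω lam 1) * forwardSeries lam (shiftBy 1 ω) = invDensity lam ω := by
  rw [forwardSeries_eq lam (shiftBy (-1) ω), shiftBy_shiftBy, add_neg_cancel, shiftBy_zero,
    biasedRho_shiftBy, add_neg_cancel, invDensity]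
  conv_rhs => enter [1]; rw [forwardSeries_eq]
  ring

/-- The (unnormalized) invariant measure of the environment seen from the walk. -/
noncomputable def invMeasure (P : Measure Env) (lam : ℝ) : Measure Env :=
  P.withDensity (invDensity lam)

section Invariant

variable {P : Measure Env}

theorem lintegral_invMeasure (lam : ℝ) {H : Env → ENNReal} (hH : Measurable H) :
    ∫⁻ ω, H ω ∂invMeasure P lam = ∫⁻ ω, invDensity lam ω * H ω ∂P := by
  rw [invMeasure, lintegral_withDensity_eq_lintegral_mul _ (measurable_invDensity lam) hH]
  rfl

theorem absolutelyContinuous_invMeasure (lam : ℝ) : P ≪ invMeasure P lam :=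
  withDensity_absolutelyContinuous' (measurable_invDensity lam).aemeasurable
    (ae_of_all _ (invDensity_ne_zero lam))

theorem lintegral_forwardSeries (hP : MeasurePreserving shift P P) (lam : ℝ) :
    ∫⁻ ω, forwardSeries lam ω ∂P = ∑' i, rhoMoment P lam i := by
  unfold forwardSeries
  rw [lintegral_tsum fun i => (measurable_prod_biasedRho lam i fun j => j + 1).aemeasurable]
  exact tsum_congr fun i => lintegral_prod_biasedRho hP lam 1 i

theorem lintegral_rho_mul_forwardSeries (lam : ℝ) :
    ∫⁻ ω, ENNReal.ofReal (biasedRho ω lam 0) * forwardSeries lam ω ∂P =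
      ∑' i, rhoMoment P lam (i + 1) := by
  have h : ∀ ω, ENNReal.ofReal (biasedRho ω lam 0) * forwardSeries lam ω =
      ∑' i : ℕ, ∏ j ∈ Finset.range (i + 1), ENNReal.ofReal (biasedRho ω lam j) := fun ω => by
    rw [forwardSeries, ← ENNReal.tsum_mul_left]
    refine tsum_congr fun i => ?_
    rw [Finset.prod_range_succ', mul_comm]
    push_cast
    rfl
  simp only [h]
  rw [lintegral_tsum fun i => (measurable_prod_biasedRho lam (i + 1) fun j => j).aemeasurable]
  rfl

theorem invMeasure_univ (hP : MeasurePreserving shift P P) (lam : ℝ) :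
    invMeasure P lam Set.univ = meanPassage P lam := by
  rw [invMeasure, withDensity_apply _ .univ, Measure.restrict_univ]
  unfold invDensity
  rw [lintegral_add_left (measurable_forwardSeries lam), lintegral_forwardSeries hP,
    lintegral_rho_mul_forwardSeries, meanPassage, ENNReal.tsum_add]

/-- The measure `invMeasure` is invariant under the Markov chain of the environment seen from the
walk. -/
theorem lintegral_invMeasure_step (hP : MeasurePreserving shift P P) (lam : ℝ)
    {H : Env → ENNReal} (hH : Measurable H) :
    ∫⁻ ω, (ENNReal.ofReal (biasedLeft ω lam 0) * H (shiftBy (-1) ω) +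
      ENNReal.ofReal (biasedRight ω lam 0) * H (shiftBy 1 ω)) ∂invMeasure P lam =
    ∫⁻ ω, H ω ∂invMeasure P lam := by
  have hF := measurable_forwardSeries lam
  have hS := fun z => measurable_shiftBy z
  have hr := fun x => (measurable_biasedRho lam x).ennreal_ofReal
  have hL := (measurable_biasedLeft lam 0).ennreal_ofReal
  have hR := (measurable_biasedRight lam 0).ennreal_ofReal
  have hA : Measurable fun ω => ENNReal.ofReal (biasedLeft ω lam 0) * H (shiftBy (-1) ω) +
      ENNReal.ofReal (biasedRight ω lam 0) * H (shiftBy 1 ω) :=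
    (hL.mul (hH.comp (hS _))).add (hR.mul (hH.comp (hS _)))
  rw [lintegral_invMeasure lam hA,
    lintegral_invMeasure lam hH]
  have e1 : ∀ ω, invDensity lam ω * (ENNReal.ofReal (biasedLeft ω lam 0) * H (shiftBy (-1) ω) +
      ENNReal.ofReal (biasedRight ω lam 0) * H (shiftBy 1 ω)) =
      ENNReal.ofReal (biasedRho ω lam 0) * forwardSeries lam ω * H (shiftBy (-1) ω) +
        forwardSeries lam ω * H (shiftBy 1 ω) := fun ω => by
    rw [← invDensity_mul_left, mul_add, ← mul_assoc, ← mul_assoc, invDensity_mul_right]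
  have e2 : ∀ ω, invDensity lam ω * H ω =
      ENNReal.ofReal (biasedRho ω lam 1) * forwardSeries lam (shiftBy 1 ω) * H ω +
        forwardSeries lam (shiftBy (-1) ω) * H ω := fun ω => by
    rw [← invDensity_eq]; ring
  simp only [e1, e2]
  have h1 : Measurable fun ω =>
      ENNReal.ofReal (biasedRho ω lam 0) * forwardSeries lam ω * H (shiftBy (-1) ω) :=
    ((hr 0).mul hF).mul (hH.comp (hS _))
  have h2 : Measurable fun ω =>
      ENNReal.ofReal (biasedRho ω lam 1) * forwardSeries lam (shiftBy 1 ω) * H ω :=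
    ((hr 1).mul (hF.comp (hS 1))).mul hH
  have h3 : Measurable fun ω => forwardSeries lam ω * H (shiftBy 1 ω) := hF.mul (hH.comp (hS 1))
  rw [lintegral_add_left h1, lintegral_add_left h2]
  congr 1
  · rw [← (measurePreserving_shiftBy hP 1).lintegral_comp h1]
    refine lintegral_congr fun ω => ?_
    rw [biasedRho_shiftBy, shiftBy_shiftBy, neg_add_cancel, shiftBy_zero, zero_add]
  · rw [← (measurePreserving_shiftBy hP (-1)).lintegral_comp h3]
    refine lintegral_congr fun ω => ?_
    rw [shiftBy_shiftBy, add_neg_cancel, shiftBy_zero]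

/-- The joint time shift of the environment and the walk: the environment is seen from `X_1`
instead of `X_0`, and the trajectory starts afresh at time one. -/
def envShift (z : Env × (ℕ → ℤ)) : Env × (ℕ → ℤ) :=
  (shiftBy (z.2 1 - z.2 0) z.1, fun n => z.2 (n + 1) - z.2 1)

theorem measurable_envShift : Measurable envShift := by
  have h : Measurable fun p : Env × ℤ => shiftBy p.2 p.1 :=
    measurable_from_prod_countable_left fun z => measurable_shiftBy z
  have h1 : ∀ n, Measurable fun z : Env × (ℕ → ℤ) => z.2 n := fun n =>
    (measurable_pi_apply n).comp measurable_snd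
  refine Measurable.prodMk (h.comp (measurable_fst.prodMk ((h1 1).sub (h1 0)))) ?_
  exact measurable_pi_iff.2 fun n => (h1 (n + 1)).sub (h1 1)

theorem envShift_pathCons (s : ℤ) (ω : Env) {Y : ℕ → ℤ} (hY : Y 0 = 0) :
    envShift (ω, pathCons s Y) = (shiftBy s ω, Y) := by
  simp [envShift, pathCons, hY]

theorem envShift_iterate_fst (k : ℕ) (z : Env × (ℕ → ℤ)) :
    (envShift^[k] z).1 = shiftBy (z.2 k - z.2 0) z.1 := by
  induction k generalizing z with
  | zero => simp [shiftBy_zero]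
  | succ k ih =>
    rw [Function.iterate_succ_apply, ih]
    simp [envShift, shiftBy_shiftBy]

/-- The joint law of the environment and the walk, under which the environment seen from the walk
is stationary. -/
noncomputable def jointLaw (P : Measure Env) (lam : ℝ) : Measure (Env × (ℕ → ℤ)) :=
  invMeasure P lam ⊗ₘ walkKernel lam

theorem measurePreserving_envShift (hP : MeasurePreserving shift P P) (lam : ℝ)
    [IsFiniteMeasure (invMeasure P lam)] :
    MeasurePreserving envShift (jointLaw P lam) (jointLaw P lam) := by
  refine ⟨measurable_envShift, Measure.ext_of_lintegral _ fun F hF => ?_⟩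
  rw [lintegral_map hF measurable_envShift]
  unfold jointLaw
  have hFT : Measurable fun z => F (envShift z) := hF.comp measurable_envShift
  rw [Measure.lintegral_compProd hFT, Measure.lintegral_compProd hF]
  simp only [walkKernel_apply]
  rw [← lintegral_invMeasure_step hP lam (H := fun ω => ∫⁻ X, F (ω, X) ∂walkLaw ω lam)
    (hF.lintegral_kernel_prod_right' (κ := walkKernel lam))]
  refine lintegral_congr fun ω => ?_
  have hcons : ∀ s : ℤ, ∫⁻ Y, F (envShift (ω, pathCons s Y)) ∂walkLaw (shiftBy s ω) lam =
      ∫⁻ Y, F (shiftBy s ω, Y) ∂walkLaw (shiftBy s ω) lam := fun s => by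
    refine lintegral_congr_ae ?_
    filter_upwards [ae_walkLaw_zero (shiftBy s ω) lam] with Y hY
    rw [envShift_pathCons s ω hY]
  rw [lintegral_walkLaw ω lam (F := fun X => F (envShift (ω, X)))
    (hFT.comp measurable_prodMk_left)]
  simp only [hcons]

/-! ### The lower bound on the speed -/

/-- The local drift `ω_0^+(lam) - ω_0^-(lam)` at the origin. -/
noncomputable def localDrift (lam : ℝ) (ω : Env) : ℝ := biasedRight ω lam 0 - biasedLeft ω lam 0

theorem measurable_localDrift (lam : ℝ) : Measurable (localDrift lam) :=
  (measurable_biasedRight lam 0).sub (measurable_biasedLeft lam 0)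

theorem abs_localDrift_le (lam : ℝ) (ω : Env) : |localDrift lam ω| ≤ 1 := by
  have h1 := biased_add ω lam 0
  have h2 := biasedLeft_nonneg ω lam 0
  have h3 := biasedRight_nonneg ω lam 0
  rw [localDrift, abs_le]
  constructor <;> linarith

/-- The integrals of `ω_0^+(lam)` and `ω_0^-(lam)` are `∑_i m_i` and `∑_i m_{i+1}`, which differ
by `m_0 = 1`. -/
theorem integral_localDrift [IsProbabilityMeasure P] (hP : MeasurePreserving shift P P) (lam : ℝ)
    (hG : meanPassage P lam ≠ ⊤) : ∫ ω, localDrift lam ω ∂invMeasure P lam = 1 := by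
  have hfin : IsFiniteMeasure (invMeasure P lam) := ⟨by
    rw [invMeasure_univ hP]; exact hG.lt_top⟩
  have hb : ∀ {f : Env → ℝ}, Measurable f → (∀ ω, 0 ≤ f ω) → (∀ ω, f ω ≤ 1) →
      Integrable f (invMeasure P lam) := fun hf h0 h1 =>
    Integrable.of_bound hf.aestronglyMeasurable 1 (ae_of_all _ fun ω => by
      rw [Real.norm_of_nonneg (h0 ω)]; exact h1 ω)
  have hadd := fun ω => biased_add ω lam 0
  have hl := fun ω => biasedLeft_nonneg ω lam 0
  have hr := fun ω => biasedRight_nonneg ω lam 0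
  have hS : ∑' i, rhoMoment P lam (i + 1) ≠ ⊤ := by
    refine ne_top_of_le_ne_top hG ?_
    rw [meanPassage, ENNReal.tsum_add]
    exact le_add_self
  unfold localDrift
  rw [integral_sub (hb (measurable_biasedRight lam 0) hr fun ω => by linarith [hadd ω, hl ω])
      (hb (measurable_biasedLeft lam 0) hl fun ω => by linarith [hadd ω, hr ω]),
    integral_eq_lintegral_of_nonneg_ae (ae_of_all _ hr)
      (measurable_biasedRight lam 0).aestronglyMeasurable,
    integral_eq_lintegral_of_nonneg_ae (ae_of_all _ hl)
      (measurable_biasedLeft lam 0).aestronglyMeasurable,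
    lintegral_invMeasure lam (measurable_biasedRight lam 0).ennreal_ofReal,
    lintegral_invMeasure lam (measurable_biasedLeft lam 0).ennreal_ofReal]
  simp only [invDensity_mul_right, invDensity_mul_left]
  rw [lintegral_forwardSeries hP, lintegral_rho_mul_forwardSeries,
    tsum_eq_zero_add' ENNReal.summable, rhoMoment_zero,
    ENNReal.toReal_add ENNReal.one_ne_top hS]
  simp

/-- The position of the walk is at least the accumulated local drift, up to `o(n)`. -/
theorem ae_eventually_sum_localDrift_le (ω : Env) (lam : ℝ) {ε : ℝ} (hε : 0 < ε) :
    ∀ᵐ X ∂walkLaw ω lam, ∀ᶠ n : ℕ in atTop,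
      birkhoffSum envShift (fun z => localDrift lam z.1) n (ω, X) ≤ X n + ε * n := by
  have hd : ∀ x, |localDrift lam (shiftBy x ω)| ≤ 1 := fun x => abs_localDrift_le lam _
  have hx : ∀ x, localDrift lam (shiftBy x ω) = biasedRight ω lam x - biasedLeft ω lam x :=
    fun x => by rw [localDrift, biasedRight_shiftBy, biasedLeft_shiftBy, zero_add]
  have key := ae_eventually_additiveFunctional_le ω lam
    (ψ := fun x y => localDrift lam (shiftBy x ω) - ((y : ℝ) - x)) (C := 2) (fun x => by
      have h := abs_le.1 (hd x)
      push_cast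
      exact ⟨abs_le.2 ⟨by linarith, by linarith⟩, abs_le.2 ⟨by linarith, by linarith⟩⟩)
    (fun x => by
      have h := biased_add ω lam x
      rw [hx]
      push_cast
      refine le_of_eq ?_
      linear_combination (biasedRight ω lam x - biasedLeft ω lam x) * h) hε
  filter_upwards [key, ae_walkLaw_zero ω lam] with X hX hX0
  filter_upwards [hX] with n hn
  rw [additiveFunctional, Finset.sum_sub_distrib,
    Finset.sum_range_sub (fun k => (X k : ℝ)), hX0] at hn
  simp only [birkhoffSum, envShift_iterate_fst, hX0, sub_zero]
  push_cast at hn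
  linarith

/-- If the mean passage time is finite then the walk has asymptotic speed at least
`1 / meanPassage`. The averages of the local drift form a stationary process with mean
`1 / meanPassage`, and by the upper bound on the speed they do not exceed their mean in the limit,
so they cannot fall below it either. -/
theorem ae_eventually_speed_le [IsProbabilityMeasure P] (hP : Ergodic shift P) (lam : ℝ)
    (hG : meanPassage P lam ≠ ⊤) {ε : ℝ} (hε : 0 < ε) :
    ∀ᵐ ω ∂P, ∀ᵐ X ∂walkLaw ω lam, ∀ᶠ n : ℕ in atTop,
      ((meanPassage P lam)⁻¹.toReal - ε) * n ≤ X n := by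
  have hP' := hP.toMeasurePreserving
  set c := (meanPassage P lam)⁻¹.toReal with hc
  have hfin : IsFiniteMeasure (invMeasure P lam) := ⟨by
    rw [invMeasure_univ hP']; exact hG.lt_top⟩
  have hJfin : IsFiniteMeasure (jointLaw P lam) := by unfold jointLaw; infer_instance
  have hT := measurePreserving_envShift hP' lam
  set f : Env × (ℕ → ℤ) → ℝ := fun z => localDrift lam z.1 with hf
  have hfm : Measurable f := (measurable_localDrift lam).comp measurable_fst
  have hfC : ∀ z, |f z| ≤ 1 := fun z => abs_localDrift_le lam z.1
  have hfi : Integrable f (jointLaw P lam) :=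
    Integrable.of_bound hfm.aestronglyMeasurable 1 (ae_of_all _ hfC)
  have hmass : (jointLaw P lam) Set.univ = meanPassage P lam := by
    rw [jointLaw, Measure.compProd_apply_univ, invMeasure_univ hP']
  have hcmass : c * (jointLaw P lam).real Set.univ = 1 := by
    rw [measureReal_def, hmass, hc, ← ENNReal.toReal_mul, ENNReal.inv_mul_cancel
      (zero_lt_one.trans_le (one_le_meanPassage P lam)).ne' hG, ENNReal.toReal_one]
  have hmean : ∫ z, f z ∂jointLaw P lam = 1 := by
    rw [jointLaw, Measure.integral_compProd hfi]
    simp [hf, integral_localDrift hP' lam hG]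
  have hupper : ∀ δ : ℝ, 0 < δ → ∀ᵐ z ∂jointLaw P lam,
      ∃ n : ℕ, birkhoffSum envShift f n z < (c + δ) * n := by
    intro δ hδ
    refine Measure.ae_compProd_of_ae_ae ?_ ?_
    · have : {z | ∃ n : ℕ, birkhoffSum envShift f n z < (c + δ) * n} =
          ⋃ n : ℕ, {z | birkhoffSum envShift f n z < (c + δ) * n} := by ext; simp
      rw [this]
      exact .iUnion fun n => measurableSet_lt
        (measurable_birkhoffSum measurable_envShift hfm n) measurable_const
    · refine (withDensity_absolutelyContinuous P (invDensity lam)).ae_le ?_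
      filter_upwards [ae_eventually_le_speed hP lam (show 0 < δ / 3 by positivity)] with ω hω
      rw [walkKernel_apply]
      filter_upwards [hω, ae_eventually_sum_localDrift_le ω lam (show 0 < δ / 3 by positivity)]
        with X h1 h2
      obtain ⟨n, h1, h2, hn⟩ := (h1.and (h2.and (eventually_gt_atTop 0))).exists
      refine ⟨n, lt_of_le_of_lt h2 ?_⟩
      have : 0 < δ / 3 * (n : ℝ) := by positivity
      linarith
  have hnull : ∀ K < c, (jointLaw P lam) (slowSet envShift f K) = 0 := by
    intro K hK
    set B := slowSet envShift f K
    have hB : MeasurableSet B := measurableSet_slowSet measurable_envShift hfm K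
    have hTB : envShift ⁻¹' B = B := preimage_slowSet hfC K
    have h1 := setIntegral_le_of_birkhoffSum_lt hT hfm hfC hB hTB
      (ae_of_all _ fun z => exists_birkhoffSum_lt_of_mem_slowSet)
    have h2 : ∫ z in Bᶜ, f z ∂jointLaw P lam ≤ c * (jointLaw P lam).real Bᶜ := by
      refine le_of_forall_pos_le_add fun δ hδ => ?_
      have hm : 0 ≤ (jointLaw P lam).real Bᶜ := measureReal_nonneg
      set δ' := δ / ((jointLaw P lam).real Bᶜ + 1) with hδ'
      have h3 := setIntegral_le_of_birkhoffSum_lt hT hfm hfC hB.compl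
        (by rw [Set.preimage_compl, hTB]) (β := c + δ')
        ((hupper δ' (by positivity)).mono fun z hz _ => hz)
      have h4 : δ' * (jointLaw P lam).real Bᶜ ≤ δ := by
        rw [hδ', div_mul_eq_mul_div, div_le_iff₀ (by positivity)]
        nlinarith
      linarith
    have h3 := integral_add_compl hB hfi
    have h4 := measureReal_add_measureReal_compl (μ := jointLaw P lam) hB
    have h6 := hcmass
    rw [← h4] at h6
    rw [hmean] at h3
    have h5 : (jointLaw P lam).real B ≤ 0 := by
      by_contra! h
      nlinarith
    exact (measureReal_eq_zero_iff).1 (le_antisymm h5 measureReal_nonneg)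
  have hlower : ∀ᵐ z ∂jointLaw P lam, ∀ᶠ n : ℕ in atTop,
      (c - ε / 2) * n ≤ birkhoffSum envShift f n z := by
    filter_upwards [measure_eq_zero_iff_ae_notMem.1 (hnull (c - ε / 4) (by linarith))] with z hz
    exact eventually_le_of_notMem_slowSet hz (by linarith)
  have := (absolutelyContinuous_invMeasure lam).ae_le (Measure.ae_ae_of_ae_compProd hlower)
  filter_upwards [this] with ω hω
  rw [walkKernel_apply] at hω
  filter_upwards [hω, ae_eventually_sum_localDrift_le ω lam (half_pos hε)] with X h1 h2
  filter_upwards [h1, h2] with n h1 h2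
  linarith

end Invariant

/-! ### Reflection of the environment -/

/-- The environment seen in a mirror at the origin. -/
def reflect (ω : Env) : Env := fun x =>
  ⟨1 - (ω (-x) : ℝ), sub_pos.2 (ω (-x)).2.2, sub_lt_self _ (ω (-x)).2.1⟩

theorem measurable_reflect : Measurable reflect :=
  measurable_pi_iff.2 fun x => (measurable_left (-x)).subtype_mk

theorem right_reflect (ω : Env) (x : ℤ) : right (reflect ω) x = left ω (-x) := rfl

theorem left_reflect (ω : Env) (x : ℤ) : left (reflect ω) x = right ω (-x) :=
  sub_sub_cancel 1 (right ω (-x))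

theorem biasedRight_reflect (ω : Env) (lam : ℝ) (x : ℤ) :
    biasedRight (reflect ω) lam x = biasedLeft ω (-lam) (-x) := by
  rw [biasedRight, biasedLeft, right_reflect, left_reflect, neg_neg, add_comm]

theorem biasedLeft_reflect (ω : Env) (lam : ℝ) (x : ℤ) :
    biasedLeft (reflect ω) lam x = biasedRight ω (-lam) (-x) := by
  rw [biasedRight, biasedLeft, right_reflect, left_reflect, neg_neg, add_comm]

theorem stepKernel_reflect (ω : Env) (lam : ℝ) (x y : ℤ) :
    stepKernel (reflect ω) lam x {y} = stepKernel ω (-lam) (-x) {-y} := by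
  rw [stepKernel_singleton, stepKernel_singleton, biasedLeft_reflect, biasedRight_reflect, add_comm]
  congr 2
  · congr 1; exact propext ⟨fun h => by lia, fun h => by lia⟩
  · congr 1; exact propext ⟨fun h => by lia, fun h => by lia⟩

theorem walkLaw_reflect (ω : Env) (lam : ℝ) :
    walkLaw (reflect ω) lam = (walkLaw ω (-lam)).map (fun X n => -X n) := by
  have hm : Measurable fun (X : ℕ → ℤ) (n : ℕ) => -X n :=
    measurable_pi_iff.2 fun n => (measurable_pi_apply n).neg
  have hp : IsProbabilityMeasure ((walkLaw ω (-lam)).map (fun X n => -X n)) :=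
    Measure.isProbabilityMeasure_map hm.aemeasurable
  have hc : ∀ n (x : ℕ → ℤ), (fun (X : ℕ → ℤ) (n : ℕ) => -X n) ⁻¹' pathCylinder n x =
      pathCylinder n (fun i => -x i) := fun n x => by
    ext X; simp [pathCylinder, neg_eq_iff_eq_neg]
  symm
  refine eq_walkLaw (fun x => ?_) fun n x => ?_
  · rw [Measure.map_apply hm (measurableSet_pathCylinder _ _), hc, walkLaw_pathCylinder_zero]
    simp
  · rw [Measure.map_apply hm (measurableSet_pathCylinder _ _),
      Measure.map_apply hm (measurableSet_pathCylinder _ _), hc, hc, walkLaw_pathCylinder_succ,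
      stepKernel_reflect]

theorem ergodic_reflect {P : Measure Env} (hP : Ergodic shift P) :
    Ergodic shift (P.map reflect) := by
  have h : Ergodic (shiftBy (-1)) P := Ergodic.symm (e := shiftEquiv 1) hP
  refine MeasurePreserving.ergodic_of_ergodic_semiconj ⟨measurable_reflect, rfl⟩ h hP.measurable ?_
  intro ω
  funext x
  simp [reflect, shift, shiftBy, add_comm]

theorem ae_walkLaw_of_reflect {P : Measure Env} {lam : ℝ} {p : (ℕ → ℤ) → Prop}
    (h : ∀ᵐ ω ∂P.map reflect, ∀ᵐ X ∂walkLaw ω lam, p X) :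
    ∀ᵐ ω ∂P, ∀ᵐ X ∂walkLaw ω (-lam), p fun n => -X n := by
  filter_upwards [ae_of_ae_map measurable_reflect.aemeasurable h] with ω hω
  rw [walkLaw_reflect] at hω
  exact ae_of_ae_map (measurable_pi_iff.2 fun n => (measurable_pi_apply n).neg).aemeasurable hω

/-! ### The formula for the velocity -/

theorem isVelocity_of_bounds {P : Measure Env} {lam v : ℝ}
    (hle : ∀ ε : ℝ, 0 < ε → ∀ᵐ ω ∂P, ∀ᵐ X ∂walkLaw ω lam, ∀ᶠ n : ℕ in atTop,
      (X n : ℝ) ≤ (v + ε) * n)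
    (hge : ∀ ε : ℝ, 0 < ε → ∀ᵐ ω ∂P, ∀ᵐ X ∂walkLaw ω lam, ∀ᶠ n : ℕ in atTop,
      (v - ε) * n ≤ (X n : ℝ)) : IsVelocity P lam v := by
  have h1 : ∀ᵐ ω ∂P, ∀ j : ℕ, ∀ᵐ X ∂walkLaw ω lam, ∀ᶠ n : ℕ in atTop,
      (X n : ℝ) ≤ (v + 1 / (j + 1)) * n := ae_all_iff.2 fun j => hle _ (by positivity)
  have h2 : ∀ᵐ ω ∂P, ∀ j : ℕ, ∀ᵐ X ∂walkLaw ω lam, ∀ᶠ n : ℕ in atTop,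
      (v - 1 / (j + 1)) * n ≤ (X n : ℝ) := ae_all_iff.2 fun j => hge _ (by positivity)
  filter_upwards [h1, h2] with ω h1 h2
  filter_upwards [ae_all_iff.2 h1, ae_all_iff.2 h2] with X h1 h2
  refine tendsto_order.2 ⟨fun a ha => ?_, fun a ha => ?_⟩
  · obtain ⟨j, hj⟩ := exists_nat_one_div_lt (sub_pos.2 ha)
    filter_upwards [h2 j, eventually_gt_atTop 0] with n hn hn0
    have hn0' : (0 : ℝ) < n := Nat.cast_pos.2 hn0
    rw [lt_div_iff₀ hn0']
    exact lt_of_lt_of_le (mul_lt_mul_of_pos_right (by linarith) hn0') hn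
  · obtain ⟨j, hj⟩ := exists_nat_one_div_lt (sub_pos.2 ha)
    filter_upwards [h1 j, eventually_gt_atTop 0] with n hn hn0
    have hn0' : (0 : ℝ) < n := Nat.cast_pos.2 hn0
    rw [div_lt_iff₀ hn0']
    exact lt_of_le_of_lt hn (mul_lt_mul_of_pos_right (by linarith) hn0')

theorem IsVelocity.unique {P : Measure Env} [IsProbabilityMeasure P] {lam v w : ℝ}
    (hv : IsVelocity P lam v) (hw : IsVelocity P lam w) : v = w := by
  obtain ⟨ω, h1, h2⟩ := (hv.and hw).exists
  obtain ⟨X, h1, h2⟩ := (h1.and h2).exists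
  exact tendsto_nhds_unique h1 h2

/-- The speed `1 / meanPassage` of the walk to the right; it is zero if the mean passage time is
infinite. -/
noncomputable def rightSpeed (P : Measure Env) (lam : ℝ) : ℝ := (meanPassage P lam)⁻¹.toReal

theorem rightSpeed_nonneg (P : Measure Env) (lam : ℝ) : 0 ≤ rightSpeed P lam :=
  ENNReal.toReal_nonneg

theorem rightSpeed_pos_iff {P : Measure Env} [IsProbabilityMeasure P] {lam : ℝ} :
    0 < rightSpeed P lam ↔ meanPassage P lam ≠ ⊤ := by
  rw [rightSpeed, ENNReal.toReal_pos_iff]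
  simp [lt_top_iff_ne_top, (zero_lt_one.trans_le (one_le_meanPassage P lam)).ne']

/-- The speed of the walk to the left, which is the speed to the right of the mirror image. -/
noncomputable def leftSpeed (P : Measure Env) (lam : ℝ) : ℝ := rightSpeed (P.map reflect) (-lam)

section Velocity

variable {P : Measure Env} [IsProbabilityMeasure P]

instance : IsProbabilityMeasure (P.map reflect) :=
  Measure.isProbabilityMeasure_map measurable_reflect.aemeasurable

theorem ae_eventually_neg_leftSpeed_le (hP : Ergodic shift P) (lam : ℝ) {ε : ℝ} (hε : 0 < ε) :
    ∀ᵐ ω ∂P, ∀ᵐ X ∂walkLaw ω lam, ∀ᶠ n : ℕ in atTop, (-leftSpeed P lam - ε) * n ≤ (X n : ℝ) := by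
  have h := ae_walkLaw_of_reflect (ae_eventually_le_speed (ergodic_reflect hP) (-lam) hε)
  rw [neg_neg] at h
  filter_upwards [h] with ω hω
  filter_upwards [hω] with X hX
  filter_upwards [hX] with n hn
  push_cast at hn
  rw [leftSpeed, rightSpeed]
  linarith

theorem ae_eventually_le_neg_leftSpeed (hP : Ergodic shift P) (lam : ℝ)
    (hG : meanPassage (P.map reflect) (-lam) ≠ ⊤) {ε : ℝ} (hε : 0 < ε) :
    ∀ᵐ ω ∂P, ∀ᵐ X ∂walkLaw ω lam, ∀ᶠ n : ℕ in atTop, (X n : ℝ) ≤ (-leftSpeed P lam + ε) * n := by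
  have h := ae_walkLaw_of_reflect (ae_eventually_speed_le (ergodic_reflect hP) (-lam) hG hε)
  rw [neg_neg] at h
  filter_upwards [h] with ω hω
  filter_upwards [hω] with X hX
  filter_upwards [hX] with n hn
  push_cast at hn
  rw [leftSpeed, rightSpeed]
  linarith

theorem isVelocity_rightSpeed (hP : Ergodic shift P) {lam : ℝ} (h : 0 < rightSpeed P lam) :
    IsVelocity P lam (rightSpeed P lam) :=
  isVelocity_of_bounds (fun _ hε => ae_eventually_le_speed hP lam hε)
    (fun _ hε => ae_eventually_speed_le hP lam (rightSpeed_pos_iff.1 h) hε)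

theorem isVelocity_neg_leftSpeed (hP : Ergodic shift P) {lam : ℝ} (h : 0 < leftSpeed P lam) :
    IsVelocity P lam (-leftSpeed P lam) :=
  isVelocity_of_bounds
    (fun _ hε => ae_eventually_le_neg_leftSpeed hP lam (rightSpeed_pos_iff.1 h) hε)
    (fun _ hε => ae_eventually_neg_leftSpeed_le hP lam hε)

/-- The walk cannot have a positive speed in both directions. -/
theorem leftSpeed_eq_zero (hP : Ergodic shift P) {lam : ℝ} (h : 0 < rightSpeed P lam) :
    leftSpeed P lam = 0 := by
  by_contra hne
  have h' : 0 < leftSpeed P lam := lt_of_le_of_ne (rightSpeed_nonneg _ _) (Ne.symm hne)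
  linarith [(isVelocity_rightSpeed hP h).unique (isVelocity_neg_leftSpeed hP h')]

theorem rightSpeed_eq_zero_of_leftSpeed (hP : Ergodic shift P) {lam : ℝ}
    (h : 0 < leftSpeed P lam) : rightSpeed P lam = 0 := by
  by_contra hne
  have h' : 0 < rightSpeed P lam := lt_of_le_of_ne (rightSpeed_nonneg _ _) (Ne.symm hne)
  exact h.ne' (leftSpeed_eq_zero hP h')

theorem isVelocity_speed (hP : Ergodic shift P) (lam : ℝ) :
    IsVelocity P lam (rightSpeed P lam - leftSpeed P lam) := by
  rcases (rightSpeed_nonneg P lam).eq_or_lt' with h | h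
  · rcases (rightSpeed_nonneg (P.map reflect) (-lam)).eq_or_lt' with h' | h'
    · change leftSpeed P lam = 0 at h'
      refine isVelocity_of_bounds (fun ε hε => ?_) fun ε hε => ?_
      · rw [h', sub_zero]; exact ae_eventually_le_speed hP lam hε
      · rw [h, zero_sub]; exact ae_eventually_neg_leftSpeed_le hP lam hε
    · rw [h, zero_sub]; exact isVelocity_neg_leftSpeed hP h'
  · rw [leftSpeed_eq_zero hP h, sub_zero]; exact isVelocity_rightSpeed hP h

theorem isVelocity_velocity (hP : Ergodic shift P) (lam : ℝ) :
    IsVelocity P lam (velocity P lam) :=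
  Classical.epsilon_spec (p := fun v => IsVelocity P lam v) ⟨_, isVelocity_speed hP lam⟩

theorem velocity_eq (hP : Ergodic shift P) (lam : ℝ) :
    velocity P lam = rightSpeed P lam - leftSpeed P lam :=
  (isVelocity_velocity hP lam).unique (isVelocity_speed hP lam)

theorem velocity_eq_rightSpeed (hP : Ergodic shift P) {lam : ℝ} (h : 0 < rightSpeed P lam) :
    velocity P lam = rightSpeed P lam := by
  rw [velocity_eq hP, leftSpeed_eq_zero hP h, sub_zero]

theorem velocity_eq_neg_leftSpeed (hP : Ergodic shift P) {lam : ℝ} (h : 0 < leftSpeed P lam) :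
    velocity P lam = -leftSpeed P lam := by
  rw [velocity_eq hP, rightSpeed_eq_zero_of_leftSpeed hP h, zero_sub]

theorem rightSpeed_pos_of_velocity_pos (hP : Ergodic shift P) {lam : ℝ} (h : 0 < velocity P lam) :
    0 < rightSpeed P lam := by
  rw [velocity_eq hP] at h
  linarith [rightSpeed_nonneg (P.map reflect) (-lam),
    show leftSpeed P lam = rightSpeed _ _ from rfl]

theorem leftSpeed_pos_of_velocity_neg (hP : Ergodic shift P) {lam : ℝ} (h : velocity P lam < 0) :
    0 < leftSpeed P lam := by
  rw [velocity_eq hP] at h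
  linarith [rightSpeed_nonneg P lam]

end Velocity

/-! ### Dependence of the speed on the bias -/

section Bias

variable {P : Measure Env}

theorem rhoMoment_eq (lam : ℝ) (i : ℕ) :
    rhoMoment P lam i = ENNReal.ofReal (Real.exp (-(2 * lam))) ^ i * rhoMoment P 0 i := by
  have h : ∀ (ω : Env) (x : ℤ), ENNReal.ofReal (biasedRho ω lam x) =
      ENNReal.ofReal (Real.exp (-(2 * lam))) * ENNReal.ofReal (biasedRho ω 0 x) := fun ω x => by
    rw [← ENNReal.ofReal_mul (Real.exp_pos _).le]
    simp [biasedRho, mul_comm]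
  rw [rhoMoment]
  simp only [h, Finset.prod_mul_distrib, Finset.prod_const, Finset.card_range]
  rw [lintegral_const_mul _ (measurable_prod_biasedRho 0 i fun j => j), rhoMoment]

theorem rhoMoment_antitone (i : ℕ) : Antitone fun lam => rhoMoment P lam i := by
  intro a b hab
  beta_reduce
  rw [rhoMoment_eq a, rhoMoment_eq b]
  gcongr

theorem meanPassage_antitone : Antitone (meanPassage P) := fun _ _ hab =>
  ENNReal.tsum_le_tsum fun i =>
    add_le_add (rhoMoment_antitone i hab) (rhoMoment_antitone (i + 1) hab)

theorem rhoMoment_ne_top {lam : ℝ} (h : meanPassage P lam ≠ ⊤) (i : ℕ) :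
    rhoMoment P lam i ≠ ⊤ :=
  ne_top_of_le_ne_top h (le_self_add.trans (ENNReal.le_tsum i))

variable [IsProbabilityMeasure P]

theorem rhoMoment_ne_zero (lam : ℝ) (i : ℕ) : rhoMoment P lam i ≠ 0 := by
  rw [rhoMoment, Ne, lintegral_eq_zero_iff (measurable_prod_biasedRho lam i fun j => j)]
  intro h
  obtain ⟨ω, hω⟩ := h.exists
  simp only [Pi.zero_apply, Finset.prod_eq_zero_iff, ENNReal.ofReal_eq_zero] at hω
  obtain ⟨j, -, hj⟩ := hω
  exact (biasedRho_pos ω lam j).not_ge hj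

theorem rightSpeed_monotone : Monotone (rightSpeed P) := fun _ b hab =>
  ENNReal.toReal_mono
    (ENNReal.inv_ne_top.2 (zero_lt_one.trans_le (one_le_meanPassage P b)).ne')
    (ENNReal.inv_le_inv.2 (meanPassage_antitone hab))

/-- Where the mean passage time is finite it is strictly decreasing, because of the summand
`m_1 = E[ρ_0] exp (-2 lam)`. -/
theorem rightSpeed_strictMono {a b : ℝ} (ha : 0 < rightSpeed P a) (hab : a < b) :
    rightSpeed P a < rightSpeed P b := by
  have hfin := rightSpeed_pos_iff.1 ha
  have h1 : rhoMoment P b 1 < rhoMoment P a 1 := by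
    have hexp : ENNReal.ofReal (Real.exp (-(2 * b))) < ENNReal.ofReal (Real.exp (-(2 * a))) :=
      (ENNReal.ofReal_lt_ofReal_iff (Real.exp_pos _)).2 (Real.exp_lt_exp.2 (by linarith))
    have hne : rhoMoment P 0 1 ≠ ⊤ := fun h => by
      have := rhoMoment_ne_top hfin 1
      rw [rhoMoment_eq, h, pow_one, ENNReal.mul_top (ENNReal.ofReal_pos.2 (Real.exp_pos _)).ne']
        at this
      exact this rfl
    rw [rhoMoment_eq b, rhoMoment_eq a, pow_one, pow_one]
    exact (ENNReal.mul_lt_mul_iff_left (rhoMoment_ne_zero 0 1) hne).2 hexp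
  have h2 : meanPassage P b < meanPassage P a := by
    refine ENNReal.tsum_lt_tsum (i := 0)
      (ne_top_of_le_ne_top hfin (meanPassage_antitone hab.le))
      (fun i => add_le_add (rhoMoment_antitone i hab.le) (rhoMoment_antitone (i + 1) hab.le)) ?_
    rw [rhoMoment_zero, rhoMoment_zero]
    exact ENNReal.add_lt_add_left ENNReal.one_ne_top h1
  exact (ENNReal.toReal_lt_toReal
    (ENNReal.inv_ne_top.2 (zero_lt_one.trans_le (one_le_meanPassage P a)).ne')
    (ENNReal.inv_ne_top.2 (zero_lt_one.trans_le (one_le_meanPassage P b)).ne')).2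
    (ENNReal.inv_lt_inv.2 h2)

/-- The mean passage time as a power series in `exp (-2 lam)`. In `∑_i (m_i + m_{i+1})` every moment
but `m_0 = 1` occurs twice. -/
theorem toReal_meanPassage {lam : ℝ} (h : meanPassage P lam ≠ ⊤) :
    (meanPassage P lam).toReal =
      2 * ∑' i, Real.exp (-(2 * lam)) ^ i * (rhoMoment P 0 i).toReal - 1 := by
  have hr : ∀ i, (rhoMoment P lam i).toReal =
      Real.exp (-(2 * lam)) ^ i * (rhoMoment P 0 i).toReal := fun i => by
    rw [rhoMoment_eq, ENNReal.toReal_mul, ENNReal.toReal_pow,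
      ENNReal.toReal_ofReal (Real.exp_pos _).le]
  have hsum : ∑' i, rhoMoment P lam i ≠ ⊤ := by
    refine ne_top_of_le_ne_top h ?_
    rw [meanPassage, ENNReal.tsum_add]; exact le_self_add
  have hsum' : ∑' i, rhoMoment P lam (i + 1) ≠ ⊤ := by
    refine ne_top_of_le_ne_top h ?_
    rw [meanPassage, ENNReal.tsum_add]; exact le_add_self
  have h0 : (∑' i, rhoMoment P lam i).toReal = 1 + (∑' i, rhoMoment P lam (i + 1)).toReal := by
    rw [tsum_eq_zero_add' ENNReal.summable, rhoMoment_zero,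
      ENNReal.toReal_add ENNReal.one_ne_top hsum', ENNReal.toReal_one]
  rw [meanPassage, ENNReal.tsum_add, ENNReal.toReal_add hsum hsum']
  simp only [← hr]
  rw [← ENNReal.tsum_toReal_eq fun i => rhoMoment_ne_top h i]
  linarith

/-- To the right of a bias with finite mean passage time, the power series of `toReal_meanPassage`
is evaluated inside its disc of convergence. -/
theorem rightSpeed_analyticAt {a lam : ℝ} (ha : 0 < rightSpeed P a) (hlam : a < lam) :
    AnalyticAt ℝ (rightSpeed P) lam := by
  have hfin := rightSpeed_pos_iff.1 ha
  have hfin' : ∀ l, a ≤ l → meanPassage P l ≠ ⊤ := fun l hl =>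
    ne_top_of_le_ne_top hfin (meanPassage_antitone hl)
  set c : ℕ → ℝ := fun i => (rhoMoment P 0 i).toReal with hc
  have hrad : ENNReal.ofReal (Real.exp (-(2 * a))) ≤
      (FormalMultilinearSeries.ofScalars ℝ c).radius := by
    refine FormalMultilinearSeries.le_radius_of_bound _ (meanPassage P a).toReal fun i => ?_
    rw [FormalMultilinearSeries.ofScalars_norm, Real.norm_of_nonneg ENNReal.toReal_nonneg,
      Real.coe_toNNReal _ (Real.exp_pos _).le]
    have : (rhoMoment P a i).toReal = c i * Real.exp (-(2 * a)) ^ i := by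
      rw [rhoMoment_eq, ENNReal.toReal_mul, ENNReal.toReal_pow,
        ENNReal.toReal_ofReal (Real.exp_pos _).le, mul_comm]
    rw [← this]
    exact ENNReal.toReal_mono hfin (le_self_add.trans (ENNReal.le_tsum i))
  have hz : AnalyticAt ℝ (FormalMultilinearSeries.ofScalarsSum (E := ℝ) c)
      (Real.exp (-(2 * lam))) := by
    have hlt : ENNReal.ofReal (Real.exp (-(2 * lam))) <
        (FormalMultilinearSeries.ofScalars ℝ c).radius :=
      lt_of_lt_of_le ((ENNReal.ofReal_lt_ofReal_iff (Real.exp_pos _)).2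
        (Real.exp_lt_exp.2 (by linarith))) hrad
    refine ((FormalMultilinearSeries.ofScalars ℝ c).hasFPowerSeriesOnBall
      (bot_le.trans_lt hlt)).analyticAt_of_mem ?_
    rw [Metric.mem_eball, edist_zero_right, ← ofReal_norm, Real.norm_of_nonneg (Real.exp_pos _).le]
    exact hlt
  have hcomp : AnalyticAt ℝ (fun l : ℝ =>
      2 * FormalMultilinearSeries.ofScalarsSum c (Real.exp (-(2 * l))) - 1) lam := by
    have he : AnalyticAt ℝ (fun l : ℝ => Real.exp (-(2 * l))) lam :=
      analyticAt_rexp.comp ((analyticAt_const.mul analyticAt_id).neg)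
    exact (analyticAt_const.mul (hz.comp_of_eq he rfl)).sub analyticAt_const
  have heq : ∀ l, a ≤ l → (meanPassage P l).toReal =
      2 * FormalMultilinearSeries.ofScalarsSum c (Real.exp (-(2 * l))) - 1 := fun l hl => by
    rw [toReal_meanPassage (hfin' l hl), FormalMultilinearSeries.ofScalars_sum_eq]
    simp [hc, mul_comm]
  refine (hcomp.inv ?_).congr ?_
  · rw [← heq lam hlam.le]
    exact (ENNReal.toReal_pos (zero_lt_one.trans_le (one_le_meanPassage P lam)).ne'
      (hfin' lam hlam.le)).ne'
  · filter_upwards [eventually_gt_nhds hlam] with l hl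
    rw [rightSpeed, ENNReal.toReal_inv, heq l hl.le]
    rfl

end Bias

end RWRE

theorem proposition3p3 (P : MeasureTheory.Measure RWRE.Env) [MeasureTheory.IsProbabilityMeasure P]
    (hergodic : Ergodic RWRE.shift P)
    (hlog : RWRE.HasExtendedMean P (fun ω => Real.log (RWRE.rho ω 0))) :
    (∀ lam : ℝ, RWRE.IsVelocity P lam (RWRE.velocity P lam)) ∧
    Monotone (RWRE.velocity P) ∧
    RWRE.lamMinus P ≤ RWRE.lamPlus P ∧
    StrictMonoOn (RWRE.velocity P) {lam : ℝ | (lam : EReal) < RWRE.lamMinus P} ∧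
    AnalyticOnNhd ℝ (RWRE.velocity P) {lam : ℝ | (lam : EReal) < RWRE.lamMinus P} ∧
    StrictMonoOn (RWRE.velocity P) {lam : ℝ | RWRE.lamPlus P < (lam : EReal)} ∧
    AnalyticOnNhd ℝ (RWRE.velocity P) {lam : ℝ | RWRE.lamPlus P < (lam : EReal)} ∧
    (∀ lam : ℝ, RWRE.lamMinus P < (lam : EReal) → (lam : EReal) < RWRE.lamPlus P →
      RWRE.velocity P lam = 0) := by
  open RWRE in
  have hmono : Monotone (velocity P) := fun a b hab => by
    rw [velocity_eq hergodic, velocity_eq hergodic]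
    exact sub_le_sub (rightSpeed_monotone hab) (rightSpeed_monotone (neg_le_neg hab))
  -- right of a bias with positive velocity, the velocity is the speed to the right
  have hpos : ∀ a l, 0 < velocity P a → a ≤ l → 0 < rightSpeed P l ∧
      velocity P l = rightSpeed P l := fun a l ha hl => by
    have h := (rightSpeed_pos_of_velocity_pos hergodic ha).trans_le (rightSpeed_monotone hl)
    exact ⟨h, velocity_eq_rightSpeed hergodic h⟩
  have hneg : ∀ b l, velocity P b < 0 → l ≤ b → 0 < leftSpeed P l ∧
      velocity P l = -leftSpeed P l := fun b l hb hl => by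
    have h : 0 < leftSpeed P l := (leftSpeed_pos_of_velocity_neg hergodic hb).trans_le
      (rightSpeed_monotone (neg_le_neg hl))
    exact ⟨h, velocity_eq_neg_leftSpeed hergodic h⟩
  have hminus : ∀ l : ℝ, (l : EReal) < lamMinus P → ∃ b, l < b ∧ velocity P b < 0 := by
    intro l hl
    obtain ⟨_, ⟨b, hb, rfl⟩, hlb⟩ := lt_sSup_iff.1 hl
    exact ⟨b, EReal.coe_lt_coe_iff.1 hlb, hb⟩
  have hplus : ∀ l : ℝ, lamPlus P < (l : EReal) → ∃ a, a < l ∧ 0 < velocity P a := by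
    intro l hl
    obtain ⟨_, ⟨a, ha, rfl⟩, hla⟩ := sInf_lt_iff.1 hl
    exact ⟨a, EReal.coe_lt_coe_iff.1 hla, ha⟩
  refine ⟨isVelocity_velocity hergodic, hmono, ?_, ?_, ?_, ?_, ?_, ?_⟩
  · refine sSup_le ?_
    rintro _ ⟨b, hb, rfl⟩
    refine le_sInf ?_
    rintro _ ⟨a, ha, rfl⟩
    exact EReal.coe_le_coe_iff.2 (hmono.reflect_lt (lt_trans hb ha)).le
  · intro x _ y hy hxy
    obtain ⟨b, hyb, hb⟩ := hminus y hy
    rw [(hneg b x hb (hxy.trans hyb).le).2, (hneg b y hb hyb.le).2]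
    exact neg_lt_neg (rightSpeed_strictMono (hneg b y hb hyb.le).1 (neg_lt_neg hxy))
  · intro l hl
    obtain ⟨b, hlb, hb⟩ := hminus l hl
    have h1 : AnalyticAt ℝ (rightSpeed (P.map reflect)) (-l) :=
      rightSpeed_analyticAt (hneg b b hb le_rfl).1 (neg_lt_neg hlb)
    refine (h1.comp_of_eq analyticAt_id.neg rfl).neg.congr ?_
    filter_upwards [eventually_lt_nhds hlb] with x hx
    exact (hneg b x hb hx.le).2.symm
  · intro x hx y _ hxy
    obtain ⟨a, hax, ha⟩ := hplus x hx
    rw [(hpos a x ha hax.le).2, (hpos a y ha (hax.trans hxy).le).2]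
    exact rightSpeed_strictMono (hpos a x ha hax.le).1 hxy
  · intro l hl
    obtain ⟨a, hal, ha⟩ := hplus l hl
    refine (rightSpeed_analyticAt (hpos a a ha le_rfl).1 hal).congr ?_
    filter_upwards [eventually_gt_nhds hal] with x hx
    exact (hpos a x ha hx.le).2.symm
  · intro l h1 h2
    refine le_antisymm (not_lt.1 fun h => ?_) (not_lt.1 fun h => ?_)
    · exact h2.not_ge (sInf_le ⟨l, h, rfl⟩)
    · exact h1.not_ge (le_sSup ⟨l, h, rfl⟩)
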